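/- **Theorem (matrix Khintchine inequalities).** For matrices $\alpha_1,\dots,\alpha_n\in M_{m\times k}(\mathbb C)$ put $$\|\alpha\|_{RC}=\max\Big\{\Big\|\sum_{j=1}^n\alpha_j\alpha_j^*\Big\|^{1/2},\ \Big\|\sum_{j=1}^n\alpha_j^*\alpha_j\Big\|^{1/2}\Big\},$$ where all norms are operator norms. Let $H$ be a complex Hilbert space with inner product conjugate-linear in the first variable. For $|q|\le 1$ and weights $w_n\ge 0$, equip the algebraic full Fock space $\bigoplus_{n\ge0}H^{\otimes n}$ (with $H^{\otimes 0}=\mathbb C\Omega$) with the positive semidefinite form in which different tensor powers are orthogonal and $$\langle x_1\otimes\cdots\otimes x_n,\ y_1\otimes\cdots\otimes y_n\rangle=w_n\sum_{\pi\in S_n}q^{\mathrm{inv}(\pi)}\prod_{i=1}^n\langle x_i,y_{\pi(i)}\rangle ,$$ where $\mathrm{inv}(\pi)$ is the number of inversions and $0^0=1$. Let $\mathcal F$ be the Hilbert space obtained by dividing out the null vectors and completing. The creation operator of $f\in H$ is $a^+(f)(x_1\otimes\cdots\otimes x_n)=f\otimes x_1\otimes\cdots\otimes x_n$, the annihilation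 operator is $a(f)=a^+(f)^*$, and the Gaussian operator is $G(f)=a(f)+a^+(f)$. Consider the following families: * *$q$-continuous Gaussians*, $-1<q<1$: $w_n=1$; * *$q$-discrete Gaussians*, $0\le q<1$: $w_n=q^{\binom n2}$; * *Kesten Gaussians* with parameter $t\ge 0$: $q=0$, $w_0=1$ and $w_n=t^{\,n-1}$ for $n\ge1$. For each of these families and each value of its parameter ($q$ or $t$) there are constants $K_1,K_2>0$, depending only on that parameter, such that for every complex Hilbert space $H$, every $n$ and every orthonormal system $f_1,\dots,f_n$ in $H$, the operators $a^+(f_j)$ extend to bounded operators on $\mathcal F$, and the Gaussian operators $X_j=G(f_j)$ satisfy $$K_1\,\|\alpha\|_{RC}\ \le\ \Big\|\sum_{j=1}^n\alpha_j\otimes X_j\Big\|\ \le\ K_2\,\|\alpha\|_{RC}$$ for all $m,k$ and all $\alpha_1,\dots,\alpha_n\in M_{m\times k}(\mathbb C)$, where $\sum_j\alpha_j\otimes X_j$ acts from $\mathbb C^k\otimes\mathcal F$ to $\mathbb C^m\otimes\mathcal F$. For the *Boolean Gaussians* $G^B(f)=a(f)+a^+(f)$ on the Boolean Fock space $\mathbb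 C\Omega\oplus H$, where $a^+(f)(z\Omega+h)=zf$ and $a(f)(z\Omega+h)=\langle f,h\rangle\Omega$, equality holds: for every complex Hilbert space $H$, every orthonormal system $f_1,\dots,f_n$ in $H$ and all $\alpha_1,\dots,\alpha_n\in M_{m\times k}(\mathbb C)$, $$\Big\|\sum_{j=1}^n\alpha_j\otimes G^B(f_j)\Big\|=\|\alpha\|_{RC}.$$ -/

import Mathlib

open scoped TensorProduct Matrix Matrix.Norms.L2Operator InnerProductSpace

universe u

noncomputable section

namespace FockKhintchine

/-- The number of inversions of a permutation. -/
def inversions {n : ℕ} (π : Equiv.Perm (Fin n)) : ℕ :=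
  (Finset.univ.filter fun p : Fin n × Fin n => p.1 < p.2 ∧ π p.2 < π p.1).card

/-- The parameters of a deformed inner product on the full Fock space: on `H^{⊗ n}` it is
`weight n * ∑ π, q ^ inv π * ∏ i, ⟨x i, y (π i)⟩`. -/
structure Deformation where
  q : ℝ
  abs_q_le : |q| ≤ 1
  weight : ℕ → ℝ
  weight_nonneg : ∀ n, 0 ≤ weight n

/-- The deformation of the continuous `q`-Gaussians. -/
def qContinuous (q : ℝ) (hq : |q| < 1) : Deformation where
  q := q
  abs_q_le := hq.le
  weight := fun _ => 1
  weight_nonneg := fun _ => zero_le_one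

/-- The deformation of the discrete `q`-Gaussians (discrete `q`-Hermite polynomials of type I). -/
def qDiscrete (q : ℝ) (h0 : 0 ≤ q) (h1 : q < 1) : Deformation where
  q := q
  abs_q_le := by rw [abs_of_nonneg h0]; exact h1.le
  weight := fun n => q ^ n.choose 2
  weight_nonneg := fun _ => pow_nonneg h0 _

/-- The deformation of the Kesten Gaussians: the full Fock space, whose inner product on
`H^{⊗ n}` is multiplied by `t ^ (n - 1)` for `n ≥ 1` (and unchanged for `n = 0`).
A single Gaussian has Jacobi coefficients `1, t, t, t, …`, which is the Kesten law. -/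
def kesten (t : ℝ) (ht : 0 ≤ t) : Deformation where
  q := 0
  abs_q_le := by simp
  weight := fun n => t ^ (n - 1)
  weight_nonneg := fun _ => pow_nonneg ht _

section Kernel

open scoped ComplexOrder

variable {H : Type u} [NormedAddCommGroup H] [InnerProductSpace ℂ H]

/-- `⟨x₁ ⊗ ⋯ ⊗ xₙ, y₁ ⊗ ⋯ ⊗ yₙ⟩_q = ∑ π, q ^ inv π * ∏ i, ⟨x i, y (π i)⟩`. -/
def qKernel (q : ℝ) {n : ℕ} (x y : Fin n → H) : ℂ :=
  ∑ π : Equiv.Perm (Fin n), (q : ℂ) ^ inversions π * ∏ i, ⟪x i, y (π i)⟫_ℂ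

/-- The deformed inner product of the simple tensors given by two words `x` and `y`. -/
def fockKernel (D : Deformation) (x y : Σ n : ℕ, (Fin n → H)) : ℂ :=
  if h : x.1 = y.1 then (D.weight x.1 : ℂ) * qKernel D.q x.2 (y.2 ∘ Fin.cast h) else 0

lemma inversions_eq_card {n : ℕ} (σ τ : Equiv.Perm (Fin n)) :
    inversions (τ * σ⁻¹) = ((Finset.univ.filter fun p : Fin n × Fin n => p.1 < p.2).filter
      fun p => ¬ (σ p.1 < σ p.2 ↔ τ p.1 < τ p.2)).card := by
  symm
  refine Finset.card_bij'
    (fun p _ => if σ p.1 < σ p.2 then (σ p.1, σ p.2) else (σ p.2, σ p.1))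
    (fun p _ => if σ.symm p.1 < σ.symm p.2 then (σ.symm p.1, σ.symm p.2)
      else (σ.symm p.2, σ.symm p.1)) ?_ ?_ ?_ ?_
  · rintro ⟨a, b⟩ h
    simp only [Finset.mem_univ, Finset.mem_filter, true_and] at h ⊢
    have h1 : σ a ≠ σ b := fun e => h.1.ne (σ.injective e)
    have h2 : τ a ≠ τ b := fun e => h.1.ne (τ.injective e)
    by_cases hs : σ a < σ b
    · simp [hs]
      grind
    · simp [hs]
      grind
  · rintro ⟨a, b⟩ h
    simp only [Finset.mem_univ, Finset.mem_filter, true_and] at h ⊢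
    have h1 : σ.symm a ≠ σ.symm b := fun e => h.1.ne (σ.symm.injective e)
    have h3 : τ (σ.symm b) < τ (σ.symm a) := by simpa using h.2
    by_cases hs : σ.symm a < σ.symm b
    · simp [hs]
      grind
    · simp [hs]
      grind
  · rintro ⟨a, b⟩ h
    simp only [Finset.mem_univ, Finset.mem_filter, true_and] at h
    by_cases hs : σ a < σ b
    · simp [hs, h.1]
    · simp [hs, h.1.le.not_gt]
  · rintro ⟨a, b⟩ h
    simp only [Finset.mem_univ, Finset.mem_filter, true_and] at h
    by_cases hs : σ.symm a < σ.symm b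
    · simp [hs, h.1]
    · simp [hs, h.1.le.not_gt]

lemma posSemidef_prod {X ι : Type*} (s : Finset ι) (M : ι → Matrix X X ℂ)
    (hM : ∀ i ∈ s, (M i).PosSemidef) :
    (Matrix.of fun x y => ∏ i ∈ s, M i x y : Matrix X X ℂ).PosSemidef := by
  classical
  induction s using Finset.induction_on with
  | empty =>
    refine ⟨by ext; simp, fun f => ?_⟩
    have : (f.sum fun i xi => f.sum fun j xj => star xi *
        (Matrix.of fun x y => ∏ i ∈ (∅ : Finset ι), M i x y : Matrix X X ℂ) i j * xj)
        = star (f.sum fun _ a => a) * f.sum fun _ a => a := by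
      simp [Finsupp.sum, Finset.sum_mul_sum]
    rw [this]
    exact star_mul_self_nonneg _
  | insert a s ha ih =>
    have := (hM a (by simp)).hadamard (ih fun i hi => hM i (by simp [hi]))
    have he : (Matrix.of fun x y => ∏ i ∈ insert a s, M i x y : Matrix X X ℂ)
        = M a ⊙ Matrix.of fun x y => ∏ i ∈ s, M i x y := by
      ext x y
      simp [Finset.prod_insert ha]
    rw [he]
    exact this

lemma posSemidef_qPow (q : ℝ) (hq : |q| ≤ 1) (n : ℕ) :
    (Matrix.of fun σ τ : Equiv.Perm (Fin n) => (q : ℂ) ^ inversions (τ * σ⁻¹)).PosSemidef := by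
  obtain ⟨h1, h2⟩ := abs_le.1 hq
  let v : Fin n × Fin n → Equiv.Perm (Fin n) → ℂ := fun p σ => if σ p.1 < σ p.2 then 1 else -1
  have key := posSemidef_prod (Finset.univ.filter fun p : Fin n × Fin n => p.1 < p.2)
    (fun p => (((1 + q) / 2 : ℝ) : ℂ) • Matrix.vecMulVec (1 : Equiv.Perm (Fin n) → ℂ) (star 1)
      + (((1 - q) / 2 : ℝ) : ℂ) • Matrix.vecMulVec (v p) (star (v p))) (fun p _ =>
      ((Matrix.posSemidef_vecMulVec_self_star _).smul
        (Complex.zero_le_real.2 (by linarith))).add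
      ((Matrix.posSemidef_vecMulVec_self_star _).smul
        (Complex.zero_le_real.2 (by linarith))))
  convert key using 1
  ext σ τ
  simp only [Matrix.of_apply, inversions_eq_card, ← Finset.prod_const]
  rw [Finset.prod_filter]
  refine Finset.prod_congr rfl fun p _ => ?_
  simp only [Matrix.add_apply, Matrix.smul_apply, Matrix.vecMulVec_apply, v, Pi.star_apply,
    Pi.one_apply, smul_eq_mul]
  by_cases ha : σ p.1 < σ p.2 <;> by_cases hb : τ p.1 < τ p.2 <;> simp [ha, hb] <;> ring

lemma posSemidef_inner {X : Type*} (v : X → H) :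
    (Matrix.of fun x y => ⟪v x, v y⟫_ℂ).PosSemidef := by
  refine ⟨by ext; simp, fun f => ?_⟩
  have : (f.sum fun i xi => f.sum fun j xj => star xi *
      (Matrix.of fun x y => ⟪v x, v y⟫_ℂ : Matrix X X ℂ) i j * xj)
      = ⟪f.sum fun i a => a • v i, f.sum fun i a => a • v i⟫_ℂ := by
    simp only [Finsupp.sum, sum_inner, inner_sum, inner_smul_left, inner_smul_right,
      Finset.mul_sum]
    rw [Finset.sum_comm]
    refine Finset.sum_congr rfl fun i _ => Finset.sum_congr rfl fun j _ => ?_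
    simp only [Matrix.of_apply]
    change (starRingEnd ℂ) _ * _ * _ = _
    ring
  rw [this, inner_self_eq_norm_sq_to_K]
  have h0 : (0 : ℝ) ≤ ‖f.sum fun i a => a • v i‖ ^ 2 := sq_nonneg _
  have h1 := Complex.zero_le_real.2 h0
  push_cast at h1
  exact h1

lemma posSemidef_sum_sum {X ι : Type*} [Fintype ι] {N : Matrix (ι × X) (ι × X) ℂ}
    (hN : N.PosSemidef) :
    (Matrix.of fun x y => ∑ σ, ∑ τ, N (σ, x) (τ, y) : Matrix X X ℂ).PosSemidef := by
  classical
  refine ⟨?_, fun f => ?_⟩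
  · ext x y
    simp only [Matrix.conjTranspose_apply, Matrix.of_apply, star_sum, hN.isHermitian.apply]
    exact Finset.sum_comm
  · let g : ι × X →₀ ℂ := Finsupp.onFinset (Finset.univ ×ˢ f.support) (fun p => f p.2)
      (fun p hp => by simpa using hp)
    have hg : ∀ F : ι × X → ℂ → ℂ, (∀ p, F p 0 = 0) →
        g.sum F = f.sum fun x a => ∑ σ, F (σ, x) a := by
      intro F hF
      rw [Finsupp.onFinset_sum _ hF, Finset.sum_product, Finset.sum_comm]
      rfl
    have := hN.2 g
    rw [hg _ (by simp)] at this
    convert this using 1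
    refine Finset.sum_congr rfl fun x _ => ?_
    simp_rw [hg _ fun p => mul_zero _]
    simp only [Finsupp.sum, Matrix.of_apply]
    rw [Finset.sum_comm]
    refine Finset.sum_congr rfl fun y _ => ?_
    simp only [Finset.mul_sum, Finset.sum_mul]

lemma posSemidef_qKernel (q : ℝ) (hq : |q| ≤ 1) (n : ℕ) :
    (Matrix.of fun x y : Fin n → H => qKernel q x y).PosSemidef := by
  have h1 := (posSemidef_qPow q hq n).submatrix
    (Prod.fst : Equiv.Perm (Fin n) × (Fin n → H) → Equiv.Perm (Fin n))
  have h2 := posSemidef_prod Finset.univ _ fun (i : Fin n) _ =>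
    posSemidef_inner fun p : Equiv.Perm (Fin n) × (Fin n → H) => p.2 (p.1 i)
  have h3 := (posSemidef_sum_sum (h1.hadamard h2)).smul
    (a := ((((n.factorial : ℝ))⁻¹ : ℝ) : ℂ)) (Complex.zero_le_real.2 (by positivity))
  convert h3 using 1
  ext x y
  have h4 : ∀ σ : Equiv.Perm (Fin n), ∑ τ : Equiv.Perm (Fin n),
      (q : ℂ) ^ inversions (τ * σ⁻¹) * ∏ i, ⟪x (σ i), y (τ i)⟫_ℂ = qKernel q x y := by
    intro σ
    rw [qKernel, ← Equiv.sum_comp (Equiv.mulRight σ⁻¹)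
      fun π => (q : ℂ) ^ inversions π * ∏ i, ⟪x i, y (π i)⟫_ℂ]
    refine Finset.sum_congr rfl fun τ _ => ?_
    rw [Equiv.coe_mulRight, ← Equiv.prod_comp σ fun i => ⟪x i, y ((τ * σ⁻¹) i)⟫_ℂ]
    simp
  have h5 : (n.factorial : ℂ) ≠ 0 := by exact_mod_cast n.factorial_ne_zero
  simp only [Matrix.of_apply, Matrix.smul_apply, Matrix.hadamard_apply, Matrix.submatrix_apply,
    h4, Finset.sum_const, Finset.card_univ, Fintype.card_perm, Fintype.card_fin, smul_eq_mul,
    nsmul_eq_mul]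
  push_cast
  field_simp

lemma fockKernel_conj (D : Deformation) (x y : Σ n : ℕ, (Fin n → H)) :
    star (fockKernel D y x) = fockKernel D x y := by
  obtain ⟨n, x⟩ := x
  obtain ⟨m, y⟩ := y
  by_cases h : n = m
  · subst h
    have := (posSemidef_qKernel (H := H) D.q D.abs_q_le n).isHermitian.apply x y
    simp only [Matrix.of_apply] at this
    simp only [fockKernel, dite_true, star_mul']
    change star ((D.weight n : ℝ) : ℂ) * star (qKernel D.q y x) = _ * qKernel D.q x y
    rw [this]
    simp
  · simp [fockKernel, h, Ne.symm h]

lemma fockKernel_nonneg (D : Deformation) (f : (Σ n : ℕ, (Fin n → H)) →₀ ℂ) :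
    0 ≤ f.sum fun x a => f.sum fun y b => star a * fockKernel D x y * b := by
  classical
  rw [Finsupp.sigma_sum]
  refine Finset.sum_nonneg fun n _ => ?_
  have h : ∀ x : Fin n → H, ∀ a : ℂ,
      (f.sum fun y b => star a * fockKernel D ⟨n, x⟩ y * b)
      = (f.split n).sum fun y b => star a * ((D.weight n : ℂ) * qKernel D.q x y) * b := by
    intro x a
    rw [Finsupp.sigma_sum]
    have h1 : ∀ m, m ≠ n → ((f.split m).sum fun y b =>
        star a * fockKernel D ⟨n, x⟩ ⟨m, y⟩ * b) = 0 := by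
      intro m hm
      refine Finset.sum_eq_zero fun y _ => ?_
      simp [fockKernel, Ne.symm hm]
    rw [Finset.sum_eq_single n (fun m _ hm => h1 m hm)]
    · simp [fockKernel]
    · intro hn
      have : f.split n = 0 := by
        by_contra h0
        exact hn ((Finsupp.mem_splitSupport_iff_nonzero f n).2 h0)
      simp [this]
  simp_rw [h]
  exact ((posSemidef_qKernel (H := H) D.q D.abs_q_le n).smul
    (a := (D.weight n : ℂ)) (Complex.zero_le_real.2 (D.weight_nonneg n))).2 (f.split n)

end Kernel

section Space

open scoped ComplexOrder

variable (D : Deformation) (H : Type u) [NormedAddCommGroup H] [InnerProductSpace ℂ H]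

/-- Finite linear combinations of words `x₁ … xₙ` in `H`, a word standing for the simple tensor
`x₁ ⊗ ⋯ ⊗ xₙ`. -/
def PreFock (_D : Deformation) (H : Type u) : Type u := (Σ n : ℕ, (Fin n → H)) →₀ ℂ

instance : AddCommGroup (PreFock D H) :=
  inferInstanceAs (AddCommGroup ((Σ n : ℕ, (Fin n → H)) →₀ ℂ))

instance : Module ℂ (PreFock D H) :=
  inferInstanceAs (Module ℂ ((Σ n : ℕ, (Fin n → H)) →₀ ℂ))

variable {H} in
/-- The (possibly degenerate) deformed inner product. -/
def preInner (f g : (Σ n : ℕ, (Fin n → H)) →₀ ℂ) : ℂ :=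
  f.sum fun x a => g.sum fun y b => star a * fockKernel D x y * b

instance : PreInnerProductSpace.Core ℂ (PreFock D H) where
  inner := preInner D
  conj_inner_symm (f g : (Σ n : ℕ, (Fin n → H)) →₀ ℂ) := by
    change star (preInner D g f) = preInner D f g
    simp only [preInner, Finsupp.sum, star_sum]
    rw [Finset.sum_comm]
    refine Finset.sum_congr rfl fun x _ => Finset.sum_congr rfl fun y _ => ?_
    rw [← fockKernel_conj D x y]
    simp only [star_mul', star_star]
    ring
  re_inner_nonneg f := (Complex.le_def.1 (fockKernel_nonneg D f)).1
  add_left (f g h : (Σ n : ℕ, (Fin n → H)) →₀ ℂ) := by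
    change preInner D (f + g) h = preInner D f h + preInner D g h
    rw [preInner, Finsupp.sum_add_index'] <;> simp [preInner, add_mul, Finsupp.sum_add]
  smul_left (f g : (Σ n : ℕ, (Fin n → H)) →₀ ℂ) r := by
    change preInner D (r • f) g = star r * preInner D f g
    rw [preInner, Finsupp.sum_smul_index] <;> simp [preInner, Finsupp.mul_sum, mul_assoc]

instance : SeminormedAddCommGroup (PreFock D H) :=
  InnerProductSpace.Core.toSeminormedAddCommGroup (𝕜 := ℂ)

instance : InnerProductSpace ℂ (PreFock D H) := .ofCore _

/-- The deformed Fock space: the Hilbert space obtained from `⨁ n, H^{⊗ n}` with the deformed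
inner product by dividing out null vectors and completing. It is generated by words; the
multilinearity relations between words are null vectors, see `tensor`. -/
abbrev Fock : Type u := UniformSpace.Completion (PreFock D H)

variable {H}

/-- The class in the Fock space of the simple tensor `x₁ ⊗ ⋯ ⊗ xₙ`. -/
def word {n : ℕ} (x : Fin n → H) : Fock D H :=
  ((show PreFock D H from Finsupp.single ⟨n, x⟩ 1 : PreFock D H) : Fock D H)

lemma inner_word' {n m : ℕ} (x : Fin n → H) (y : Fin m → H) :
    ⟪word D x, word D y⟫_ℂ = fockKernel D ⟨n, x⟩ ⟨m, y⟩ := by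
  rw [word, word, UniformSpace.Completion.inner_coe]
  change preInner D (Finsupp.single ⟨n, x⟩ 1) (Finsupp.single ⟨m, y⟩ 1) = _
  simp [preInner]

lemma inner_word {n : ℕ} (x y : Fin n → H) :
    ⟪word D x, word D y⟫_ℂ = (D.weight n : ℂ) * qKernel D.q x y := by
  simp [inner_word', fockKernel]

lemma inner_word_of_ne {n m : ℕ} (h : n ≠ m) (x : Fin n → H) (y : Fin m → H) :
    ⟪word D x, word D y⟫_ℂ = 0 := by
  simp [inner_word', fockKernel, h]

lemma dense_span_word :
    Dense (Submodule.span ℂ {v : Fock D H | ∃ (n : ℕ) (x : Fin n → H), v = word D x} :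
      Set (Fock D H)) := by
  refine UniformSpace.Completion.denseRange_coe.mono ?_
  rintro _ ⟨f, rfl⟩
  refine Finsupp.induction_linear (motive := fun f : (Σ n : ℕ, (Fin n → H)) →₀ ℂ =>
    ((show PreFock D H from f : PreFock D H) : Fock D H) ∈ _) f ?_ ?_ ?_
  · exact (UniformSpace.Completion.coe_zero (α := PreFock D H)) ▸ Submodule.zero_mem _
  · intro f g hf hg
    have := UniformSpace.Completion.coe_add (α := PreFock D H) f g
    exact this ▸ Submodule.add_mem _ hf hg
  · rintro ⟨n, x⟩ a
    have h1 : (Finsupp.single (⟨n, x⟩ : Σ n : ℕ, (Fin n → H)) a) = a • Finsupp.single ⟨n, x⟩ 1 := by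
      simp
    have h2 := UniformSpace.Completion.coe_smul (M := ℂ) (X := PreFock D H) a
      (Finsupp.single ⟨n, x⟩ 1)
    rw [h1]
    exact h2 ▸ Submodule.smul_mem _ _ (Submodule.subset_span ⟨n, x, rfl⟩)

lemma eq_of_inner_word {v w : Fock D H}
    (h : ∀ (n : ℕ) (x : Fin n → H), ⟪word D x, v⟫_ℂ = ⟪word D x, w⟫_ℂ) : v = w := by
  rw [← sub_eq_zero]
  refine (dense_span_word D).eq_zero_of_inner_right ℂ fun u hu => ?_
  induction hu using Submodule.span_induction with
  | mem u hu =>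
    obtain ⟨n, x, rfl⟩ := hu
    rw [inner_sub_right, h n x, sub_self]
  | zero => simp
  | add u u' _ _ h1 h2 => rw [inner_add_left, h1, h2, add_zero]
  | smul a u _ h1 => rw [inner_smul_left, h1, mul_zero]

lemma qKernel_eq_multilinear (q : ℝ) {n : ℕ} (x : Fin n → H) :
    ∃ L : MultilinearMap ℂ (fun _ : Fin n => H) ℂ, ∀ y, qKernel q x y = L y := by
  refine ⟨∑ π : Equiv.Perm (Fin n), (q : ℂ) ^ inversions π •
    (MultilinearMap.mkPiAlgebra ℂ (Fin n) ℂ).compLinearMap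
      (fun j => (innerSL ℂ (x (π.symm j))).toLinearMap), fun y => ?_⟩
  simp only [qKernel, sum_apply, smul_apply,
    MultilinearMap.compLinearMap_apply, MultilinearMap.mkPiAlgebra_apply, smul_eq_mul]
  refine Finset.sum_congr rfl fun π _ => ?_
  congr 1
  rw [← Equiv.prod_comp π fun j => ((innerSL ℂ (x (π.symm j))).toLinearMap (y j) : ℂ)]
  simp

/-- The canonical multilinear map `(x₁, …, xₙ) ↦ x₁ ⊗ ⋯ ⊗ xₙ` into the Fock space; the vacuum
is its value for `n = 0`. -/
def tensor (n : ℕ) : MultilinearMap ℂ (fun _ : Fin n => H) (Fock D H) :=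
  MultilinearMap.mk' (word D)
    (fun x i a b => eq_of_inner_word D fun m z => by
      rw [inner_add_right]
      by_cases h : m = n
      · subst h
        obtain ⟨L, hL⟩ := qKernel_eq_multilinear D.q z
        simp only [inner_word, hL, L.map_update_add, mul_add]
      · simp only [inner_word_of_ne D h, add_zero])
    (fun x i c a => eq_of_inner_word D fun m z => by
      rw [inner_smul_right]
      by_cases h : m = n
      · subst h
        obtain ⟨L, hL⟩ := qKernel_eq_multilinear D.q z
        simp only [inner_word, hL, L.map_update_smul, smul_eq_mul, mul_left_comm]
      · simp only [inner_word_of_ne D h, mul_zero])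

/-- `A` is the (bounded) creation operator of `f`: `A (x₁ ⊗ ⋯ ⊗ xₙ) = f ⊗ x₁ ⊗ ⋯ ⊗ xₙ`.
There is at most one such `A`, since the simple tensors span a dense subspace. -/
def IsCreation (f : H) (A : Fock D H →L[ℂ] Fock D H) : Prop :=
  ∀ (n : ℕ) (x : Fin n → H), A (tensor D n x) = tensor D (n + 1) (Fin.cons f x)

/-- `X` is the Gaussian operator of `f`: the sum of the creation operator of `f` and its adjoint,
the annihilation operator of `f`. -/
def IsGaussian (f : H) (X : Fock D H →L[ℂ] Fock D H) : Prop :=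
  ∃ A : Fock D H →L[ℂ] Fock D H, IsCreation D f A ∧ X = A + ContinuousLinearMap.adjoint A

end Space

section Boolean

variable {H : Type u} [NormedAddCommGroup H] [InnerProductSpace ℂ H]

/-- The Boolean Fock space `ℂ Ω ⊕ H`. -/
abbrev BooleanFock (H : Type u) : Type u := WithLp 2 (ℂ × H)

/-- The Boolean creation operator `z Ω + h ↦ z f`. -/
def booleanCreation (f : H) : BooleanFock H →L[ℂ] BooleanFock H :=
  (WithLp.prodContinuousLinearEquiv 2 ℂ ℂ H).symm.toContinuousLinearMap ∘L
    ((0 : ℂ × H →L[ℂ] ℂ).prod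
      ((ContinuousLinearMap.toSpanSingleton ℂ f) ∘L ContinuousLinearMap.fst ℂ ℂ H)) ∘L
    (WithLp.prodContinuousLinearEquiv 2 ℂ ℂ H).toContinuousLinearMap

/-- The Boolean annihilation operator `z Ω + h ↦ ⟨f, h⟩ Ω`. -/
def booleanAnnihilation (f : H) : BooleanFock H →L[ℂ] BooleanFock H :=
  (WithLp.prodContinuousLinearEquiv 2 ℂ ℂ H).symm.toContinuousLinearMap ∘L
    ((innerSL ℂ f ∘L ContinuousLinearMap.snd ℂ ℂ H).prod (0 : ℂ × H →L[ℂ] H)) ∘L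
    (WithLp.prodContinuousLinearEquiv 2 ℂ ℂ H).toContinuousLinearMap

/-- The Boolean Gaussian operator of `f`. -/
def booleanGaussian (f : H) : BooleanFock H →L[ℂ] BooleanFock H :=
  booleanAnnihilation f + booleanCreation f

lemma booleanGaussian_apply (f : H) (v : BooleanFock H) :
    booleanGaussian f v = WithLp.toLp 2 (⟪f, v.snd⟫_ℂ, v.fst • f) := by
  simp [booleanGaussian, booleanAnnihilation, booleanCreation, ← WithLp.toLp_add]

end Boolean

/-- The operator `∑ j, α j ⊗ X j` from `ℂ^k ⊗ E` to `ℂ^m ⊗ E`, for `m × k` matrices `α j` and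
operators `X j` on a Hilbert space `E`. -/
def matrixSum {E : Type u} [NormedAddCommGroup E] [InnerProductSpace ℂ E] {n m k : ℕ}
    (α : Fin n → Matrix (Fin m) (Fin k) ℂ) (X : Fin n → (E →L[ℂ] E)) :
    (EuclideanSpace ℂ (Fin k) ⊗[ℂ] E) →L[ℂ] (EuclideanSpace ℂ (Fin m) ⊗[ℂ] E) :=
  ∑ j, TensorProduct.mapL (Matrix.toLpLin 2 2 (α j)).toContinuousLinearMap (X j)

/-- `max {‖∑ α_j α_j^*‖^(1/2), ‖∑ α_j^* α_j‖^(1/2)}`, with the operator norm of matrices acting on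
Euclidean spaces. -/
def rowColumnNorm {n m k : ℕ} (α : Fin n → Matrix (Fin m) (Fin k) ℂ) : ℝ :=
  max (√‖∑ j, α j * (α j)ᴴ‖) (√‖∑ j, (α j)ᴴ * α j‖)

/-- The matrix Khintchine inequality with constants `K₁`, `K₂` for the Gaussian operators of a
deformation: for every orthonormal system `f₁, …, fₙ` in a Hilbert space, the Gaussian operators
`X₁, …, Xₙ` exist as bounded operators on the Fock space, and
`K₁ max{…} ≤ ‖∑ α_j ⊗ X_j‖ ≤ K₂ max{…}` for all matrices `α_j` of all sizes. -/
def MatrixKhintchine (D : Deformation) (K₁ K₂ : ℝ) : Prop :=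
  ∀ (H : Type u) [NormedAddCommGroup H] [InnerProductSpace ℂ H] [CompleteSpace H]
    (n : ℕ) (f : Fin n → H), Orthonormal ℂ f →
    ∃ X : Fin n → (Fock D H →L[ℂ] Fock D H), (∀ j, IsGaussian D (f j) (X j)) ∧
      ∀ (m k : ℕ) (α : Fin n → Matrix (Fin m) (Fin k) ℂ),
        K₁ * rowColumnNorm α ≤ ‖matrixSum α X‖ ∧ ‖matrixSum α X‖ ≤ K₂ * rowColumnNorm α

end FockKhintchine

end

open FockKhintchine

/-! The lower bound, with constant 1, comes from the vacuum: annihilation kills `Ω`, so `X j Ω = f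
j` is an orthonormal family. Testing `∑ α j ⊗ X j` on `ξ ⊗ Ω` recovers the quadratic form of `∑ (α
j)ᴴ * α j`. The row term follows by symmetry of `X j` (`rowColumnNorm_le_norm_matrixSum`).

For the upper bound, `α j ⊗ A j = (1 ⊗ A j)(α j ⊗ 1)` reduces the creation part to a row estimate
`‖∑ A j (v j)‖² ≤ K ∑ ‖v j‖²` (`norm_matrixSum_le`). The annihilation part is its adjoint, and the
triangle inequality costs a factor 2.

The row estimate rests on a factorization. Splitting off the first letter writes the deformed form
on nonempty words as `⟨Φ x, Φ (R y)⟩`, where `Φ` maps into `H ⊗ F'`, the weights of `F'` are shifted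
by one, and `R = 1 + q T₁ + q² T₁ T₂ + ⋯` (`inner_nonemptyWordMap`). `R` is symmetric for the form
pulled back by `Φ`, and on each word its powers grow at rate at most `(1 - |q|)⁻¹`. By log-convexity
this rate already bounds `R` (`norm_le_of_symmetrizable`), so no norm estimate for the individual `T
i` is needed. If `w (n + 1) ≤ c * w n`, passing from `F'` to `F` costs a factor `c`, whence `K = c /
(1 - |q|)`.

In the Boolean case creation and annihilation have orthogonal ranges and orthogonal supports, so the
two parts combine by a maximum instead of a sum and the constants become 1. -/

noncomputable section

namespace FockKhintchine

/-! ### Row and column estimates for sums of tensors `α j ⊗ X j` -/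

section MatrixSum

variable {E : Type u} [NormedAddCommGroup E] [InnerProductSpace ℂ E] {n m k : ℕ}

/-- The operator between Euclidean spaces given by a matrix. -/
def matrixOp : Matrix (Fin m) (Fin k) ℂ →ₗ[ℂ]
    (EuclideanSpace ℂ (Fin k) →L[ℂ] EuclideanSpace ℂ (Fin m)) where
  toFun a := (Matrix.toLpLin 2 2 a).toContinuousLinearMap
  map_add' a b := by ext x; simp
  map_smul' c a := by ext x; simp

lemma norm_matrixOp (a : Matrix (Fin m) (Fin k) ℂ) : ‖matrixOp a‖ = ‖a‖ := rfl

lemma matrixOp_mul (a : Matrix (Fin n) (Fin m) ℂ) (b : Matrix (Fin m) (Fin k) ℂ) :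
    matrixOp (a * b) = matrixOp a ∘L matrixOp b := by
  ext x i
  simp [matrixOp, Matrix.toLpLin_apply, Matrix.mulVec_mulVec]

lemma inner_matrixOp (a : Matrix (Fin m) (Fin k) ℂ) (x : EuclideanSpace ℂ (Fin k))
    (y : EuclideanSpace ℂ (Fin m)) : ⟪matrixOp a x, y⟫_ℂ = ⟪x, matrixOp aᴴ y⟫_ℂ := by
  have := Matrix.toEuclideanLin_conjTranspose_eq_adjoint a
  change ⟪Matrix.toEuclideanLin a x, y⟫_ℂ = ⟪x, Matrix.toEuclideanLin aᴴ y⟫_ℂ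
  rw [this, LinearMap.adjoint_inner_right]

lemma inner_mapL {F G K : Type*} [NormedAddCommGroup F] [InnerProductSpace ℂ F]
    [NormedAddCommGroup G] [InnerProductSpace ℂ G] [NormedAddCommGroup K] [InnerProductSpace ℂ K]
    {f : F →L[ℂ] G} {f' : G →L[ℂ] F} {g : E →L[ℂ] K} {g' : K →L[ℂ] E}
    (hf : ∀ x y, ⟪f x, y⟫_ℂ = ⟪x, f' y⟫_ℂ) (hg : ∀ x y, ⟪g x, y⟫_ℂ = ⟪x, g' y⟫_ℂ)
    (u : F ⊗[ℂ] E) (v : G ⊗[ℂ] K) :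
    ⟪TensorProduct.mapL f g u, v⟫_ℂ = ⟪u, TensorProduct.mapL f' g' v⟫_ℂ := by
  induction u with
  | zero => simp
  | add u u' h h' => rw [map_add, inner_add_left, inner_add_left, h, h']
  | tmul x y =>
    induction v with
    | zero => simp
    | add v v' h h' => rw [map_add, inner_add_right, inner_add_right, h, h']
    | tmul x' y' =>
      rw [TensorProduct.mapL_tmul, TensorProduct.mapL_tmul, TensorProduct.inner_tmul,
        TensorProduct.inner_tmul, hf, hg]

lemma matrixSum_apply (α : Fin n → Matrix (Fin m) (Fin k) ℂ) (X : Fin n → (E →L[ℂ] E))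
    (u : EuclideanSpace ℂ (Fin k) ⊗[ℂ] E) :
    matrixSum α X u
      = ∑ j, TensorProduct.mapL (matrixOp (α j)) (X j) u := by
  rw [matrixSum, _root_.sum_apply]
  rfl

lemma matrixSum_add (α : Fin n → Matrix (Fin m) (Fin k) ℂ) (X Y : Fin n → (E →L[ℂ] E)) :
    matrixSum α (fun j => X j + Y j) = matrixSum α X + matrixSum α Y := by
  simp only [matrixSum, TensorProduct.mapL_add_right, Finset.sum_add_distrib]

lemma inner_matrixSum (α : Fin n → Matrix (Fin m) (Fin k) ℂ) {X Y : Fin n → (E →L[ℂ] E)}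
    (h : ∀ j x y, ⟪X j x, y⟫_ℂ = ⟪x, Y j y⟫_ℂ)
    (u : EuclideanSpace ℂ (Fin k) ⊗[ℂ] E) (v : EuclideanSpace ℂ (Fin m) ⊗[ℂ] E) :
    ⟪matrixSum α X u, v⟫_ℂ = ⟪u, matrixSum (fun j => (α j)ᴴ) Y v⟫_ℂ := by
  rw [matrixSum_apply, matrixSum_apply, sum_inner, inner_sum]
  refine Finset.sum_congr rfl fun j _ => inner_mapL (inner_matrixOp (α j)) (h j) u v

/-- A formal adjoint suffices, so completeness plays no role: `‖S u‖² = ⟨u, T (S u)⟩`. -/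
lemma opNorm_le_of_inner {F G : Type*} [NormedAddCommGroup F] [InnerProductSpace ℂ F]
    [NormedAddCommGroup G] [InnerProductSpace ℂ G] {S : F →L[ℂ] G} {T : G →L[ℂ] F}
    (h : ∀ u v, ⟪S u, v⟫_ℂ = ⟪u, T v⟫_ℂ) : ‖S‖ ≤ ‖T‖ := by
  refine S.opNorm_le_bound (norm_nonneg _) fun u => ?_
  by_cases h0 : ‖S u‖ = 0
  · rw [h0]; positivity
  have h1 : ‖S u‖ * ‖S u‖ ≤ ‖T‖ * ‖u‖ * ‖S u‖ := by
    calc ‖S u‖ * ‖S u‖ = ‖⟪u, T (S u)⟫_ℂ‖ := by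
          rw [← h, inner_self_eq_norm_sq_to_K (𝕜 := ℂ)]; simp [sq]
      _ ≤ ‖u‖ * ‖T (S u)‖ := norm_inner_le_norm _ _
      _ ≤ ‖u‖ * (‖T‖ * ‖S u‖) := by gcongr; exact T.le_opNorm _
      _ = _ := by ring
  exact le_of_mul_le_mul_right h1 (lt_of_le_of_ne (norm_nonneg _) (Ne.symm h0))

lemma norm_matrixSum_le_conjTranspose (α : Fin n → Matrix (Fin m) (Fin k) ℂ)
    {X Y : Fin n → (E →L[ℂ] E)} (h : ∀ j x y, ⟪X j x, y⟫_ℂ = ⟪x, Y j y⟫_ℂ) :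
    ‖matrixSum α X‖ ≤ ‖matrixSum (fun j => (α j)ᴴ) Y‖ :=
  opNorm_le_of_inner (inner_matrixSum α h)

lemma exists_eq_sum_basis_tmul (u : EuclideanSpace ℂ (Fin m) ⊗[ℂ] E) :
    ∃ v : Fin m → E, u = ∑ i, EuclideanSpace.basisFun (Fin m) ℂ i ⊗ₜ[ℂ] v i := by
  induction u with
  | zero => exact ⟨0, by simp⟩
  | add u u' h h' =>
    obtain ⟨v, rfl⟩ := h
    obtain ⟨v', rfl⟩ := h'
    exact ⟨v + v', by simp [TensorProduct.tmul_add, Finset.sum_add_distrib]⟩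
  | tmul x y =>
    refine ⟨fun i => x i • y, ?_⟩
    conv_lhs => rw [← (EuclideanSpace.basisFun (Fin m) ℂ).sum_repr x]
    rw [TensorProduct.sum_tmul]
    simp [TensorProduct.smul_tmul]

lemma norm_sq_sum_tmul {ι F : Type*} [Fintype ι] [NormedAddCommGroup F] [InnerProductSpace ℂ F]
    {e : ι → F} (he : Orthonormal ℂ e) (v : ι → E) :
    ‖∑ i, e i ⊗ₜ[ℂ] v i‖ ^ 2 = ∑ i, ‖v i‖ ^ 2 := by
  classical
  have : ((‖∑ i, e i ⊗ₜ[ℂ] v i‖ ^ 2 : ℝ) : ℂ) = ((∑ i, ‖v i‖ ^ 2 : ℝ) : ℂ) := by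
    push_cast
    have h0 := inner_self_eq_norm_sq_to_K (𝕜 := ℂ) (∑ i, e i ⊗ₜ[ℂ] v i)
    simp only [sum_inner, inner_sum, TensorProduct.inner_tmul, orthonormal_iff_ite.1 he] at h0
    refine h0.symm.trans ?_
    simp [inner_self_eq_norm_sq_to_K]
  exact_mod_cast this

/-- A row estimate for operators `A j` passes to their ampliations `1 ⊗ A j`. -/
lemma norm_sq_sum_lTensor_le {A : Fin n → (E →L[ℂ] E)} {K : ℝ}
    (hA : ∀ v : Fin n → E, ‖∑ j, A j (v j)‖ ^ 2 ≤ K * ∑ j, ‖v j‖ ^ 2)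
    (u : Fin n → EuclideanSpace ℂ (Fin m) ⊗[ℂ] E) :
    ‖∑ j, (A j).lTensor _ (u j)‖ ^ 2 ≤ K * ∑ j, ‖u j‖ ^ 2 := by
  choose v hv using fun j => exists_eq_sum_basis_tmul (u j)
  have he := (EuclideanSpace.basisFun (Fin m) ℂ).orthonormal
  have h1 : ∑ j, (A j).lTensor _ (u j)
      = ∑ i, EuclideanSpace.basisFun (Fin m) ℂ i ⊗ₜ[ℂ] ∑ j, A j (v j i) := by
    simp only [hv, map_sum, ContinuousLinearMap.lTensor_tmul, TensorProduct.tmul_sum]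
    exact Finset.sum_comm
  have h2 : ∀ j, ‖u j‖ ^ 2 = ∑ i, ‖v j i‖ ^ 2 := fun j => by
    rw [hv j, norm_sq_sum_tmul he]
  rw [h1, norm_sq_sum_tmul he]
  simp only [h2]
  rw [Finset.sum_comm, Finset.mul_sum]
  exact Finset.sum_le_sum fun i _ => hA fun j => v j i

/-- The left side is `⟨u, (S ⊗ 1) u⟩` with `S = ∑ (α j)ᴴ * α j`, and `‖S ⊗ 1‖ ≤ ‖S‖`. -/
lemma sum_norm_sq_rTensor_le (α : Fin n → Matrix (Fin m) (Fin k) ℂ)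
    (u : EuclideanSpace ℂ (Fin k) ⊗[ℂ] E) :
    ∑ j, ‖(matrixOp (α j)).rTensor E u‖ ^ 2 ≤ ‖∑ j, (α j)ᴴ * α j‖ * ‖u‖ ^ 2 := by
  set S := ∑ j, (α j)ᴴ * α j
  have h1 : ∀ j, ((‖(matrixOp (α j)).rTensor E u‖ ^ 2 : ℝ) : ℂ)
      = ⟪u, (matrixOp ((α j)ᴴ * α j)).rTensor E u⟫_ℂ := by
    intro j
    rw [matrixOp_mul, ContinuousLinearMap.rTensor_comp, ContinuousLinearMap.comp_apply,
      ContinuousLinearMap.rTensor_eq_mapL _ (matrixOp (α j)ᴴ), ← inner_mapL (inner_matrixOp (α j))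
        (g := ContinuousLinearMap.id ℂ E) (fun _ _ => rfl),
      ← ContinuousLinearMap.rTensor_eq_mapL,
      inner_self_eq_norm_sq_to_K (𝕜 := ℂ)]
    push_cast
    rfl
  have h2 : ∑ j, (matrixOp ((α j)ᴴ * α j)).rTensor E u = (matrixOp S).rTensor E u := by
    let ρ : (EuclideanSpace ℂ (Fin k) →L[ℂ] EuclideanSpace ℂ (Fin k)) →+
        (EuclideanSpace ℂ (Fin k) ⊗[ℂ] E →L[ℂ] EuclideanSpace ℂ (Fin k) ⊗[ℂ] E) :=
      AddMonoidHom.mk' (fun f => f.rTensor E) (ContinuousLinearMap.rTensor_add E)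
    change _ = ρ (matrixOp S) u
    rw [map_sum, map_sum, _root_.sum_apply]
    rfl
  have h3 : ((∑ j, ‖(matrixOp (α j)).rTensor E u‖ ^ 2 : ℝ) : ℂ)
      = ⟪u, (matrixOp S).rTensor E u⟫_ℂ := by
    rw [← h2, inner_sum, Complex.ofReal_sum]
    exact Finset.sum_congr rfl fun j _ => h1 j
  calc _ = ‖((∑ j, ‖(matrixOp (α j)).rTensor E u‖ ^ 2 : ℝ) : ℂ)‖ := by
        rw [Complex.norm_real, Real.norm_of_nonneg (by positivity)]
    _ ≤ ‖u‖ * ‖(matrixOp S).rTensor E u‖ := by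
        rw [h3]; exact norm_inner_le_norm (𝕜 := ℂ) u ((matrixOp S).rTensor E u)
    _ ≤ ‖u‖ * (‖S‖ * ‖u‖) := by
        gcongr
        refine (ContinuousLinearMap.le_opNorm _ _).trans ?_
        gcongr
        exact ContinuousLinearMap.norm_rTensor_le E (matrixOp S)
    _ = _ := by ring

/-- The sum is the row of the `1 ⊗ A j` applied to the column of the `α j ⊗ 1`; the two factors of
the bound are the norms of row and column. -/
lemma norm_matrixSum_le_column {A : Fin n → (E →L[ℂ] E)} {K : ℝ} (hK : 0 ≤ K)
    (hA : ∀ v : Fin n → E, ‖∑ j, A j (v j)‖ ^ 2 ≤ K * ∑ j, ‖v j‖ ^ 2)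
    (α : Fin n → Matrix (Fin m) (Fin k) ℂ) :
    ‖matrixSum α A‖ ≤ √K * √‖∑ j, (α j)ᴴ * α j‖ := by
  refine ContinuousLinearMap.opNorm_le_bound _ (by positivity) fun u => ?_
  have h1 : matrixSum α A u = ∑ j, (A j).lTensor _
      ((matrixOp (α j)).rTensor E u) := by
    rw [matrixSum_apply]
    refine Finset.sum_congr rfl fun j _ => ?_
    rw [← ContinuousLinearMap.comp_apply, ContinuousLinearMap.lTensor_comp_rTensor]
  rw [h1]
  refine abs_le_of_sq_le_sq' ?_ (by positivity) |>.2
  calc _ ≤ K * (‖∑ j, (α j)ᴴ * α j‖ * ‖u‖ ^ 2) :=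
        (norm_sq_sum_lTensor_le hA _).trans (by gcongr; exact sum_norm_sq_rTensor_le α u)
    _ = _ := by
        rw [mul_pow, mul_pow, Real.sq_sqrt hK, Real.sq_sqrt (norm_nonneg _), mul_assoc]

lemma rowColumnNorm_conjTranspose (α : Fin n → Matrix (Fin m) (Fin k) ℂ) :
    rowColumnNorm (fun j => (α j)ᴴ) = rowColumnNorm α := by
  simp [rowColumnNorm, max_comm]

lemma norm_matrixSum_le {A : Fin n → (E →L[ℂ] E)} {K : ℝ} (hK : 0 ≤ K)
    (hA : ∀ v : Fin n → E, ‖∑ j, A j (v j)‖ ^ 2 ≤ K * ∑ j, ‖v j‖ ^ 2)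
    (α : Fin n → Matrix (Fin m) (Fin k) ℂ) :
    ‖matrixSum α A‖ ≤ √K * rowColumnNorm α :=
  (norm_matrixSum_le_column hK hA α).trans
    (mul_le_mul_of_nonneg_left (le_max_right _ _) (Real.sqrt_nonneg _))

/-- Taking adjoints exchanges the row and column terms, and `rowColumnNorm` is their maximum. -/
lemma norm_matrixSum_le_of_adjoint {A B : Fin n → (E →L[ℂ] E)} {K : ℝ} (hK : 0 ≤ K)
    (hA : ∀ v : Fin n → E, ‖∑ j, A j (v j)‖ ^ 2 ≤ K * ∑ j, ‖v j‖ ^ 2)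
    (hB : ∀ j x y, ⟪B j x, y⟫_ℂ = ⟪x, A j y⟫_ℂ)
    (α : Fin n → Matrix (Fin m) (Fin k) ℂ) :
    ‖matrixSum α B‖ ≤ √K * rowColumnNorm α := by
  rw [← rowColumnNorm_conjTranspose]
  exact (norm_matrixSum_le_conjTranspose α hB).trans (norm_matrixSum_le hK hA _)

/-- On vectors `ξ ⊗ Ω` orthonormality of the `X j Ω` removes all cross terms, leaving the form of `∑
(α j)ᴴ * α j`. -/
lemma column_le_norm_matrixSum {X : Fin n → (E →L[ℂ] E)} {Ω : E} (hΩ : ‖Ω‖ = 1)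
    (hX : Orthonormal ℂ fun j => X j Ω) (α : Fin n → Matrix (Fin m) (Fin k) ℂ) :
    √‖∑ j, (α j)ᴴ * α j‖ ≤ ‖matrixSum α X‖ := by
  refine Real.sqrt_le_iff.2 ⟨ContinuousLinearMap.opNorm_nonneg _, ?_⟩
  set S := ∑ j, (α j)ᴴ * α j
  have key : ∀ ξ η : EuclideanSpace ℂ (Fin k), ⟪matrixOp S ξ, η⟫_ℂ
      = ⟪matrixSum α X (ξ ⊗ₜ Ω), matrixSum α X (η ⊗ₜ Ω)⟫_ℂ := by
    intro ξ η
    classical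
    simp only [S, matrixSum_apply, map_sum, TensorProduct.mapL_tmul, sum_inner, inner_sum,
      TensorProduct.inner_tmul, orthonormal_iff_ite.1 hX, _root_.sum_apply,
      matrixOp_mul, ContinuousLinearMap.comp_apply]
    simp [inner_matrixOp]
  rw [← norm_matrixOp]
  refine ContinuousLinearMap.opNorm_le_of_re_inner_le (𝕜 := ℂ) (sq_nonneg _) fun ξ η hξ hη => ?_
  have hn : ∀ ξ : EuclideanSpace ℂ (Fin k),
      ‖matrixSum α X (ξ ⊗ₜ Ω)‖ ≤ ‖matrixSum α X‖ * ‖ξ‖ := fun ξ => by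
    simpa [hΩ] using (matrixSum α X).le_opNorm (ξ ⊗ₜ Ω)
  rw [key]
  calc _ ≤ ‖matrixSum α X (ξ ⊗ₜ Ω)‖ * ‖matrixSum α X (η ⊗ₜ Ω)‖ := re_inner_le_norm _ _
    _ ≤ (‖matrixSum α X‖ * ‖ξ‖) * (‖matrixSum α X‖ * ‖η‖) := by gcongr <;> exact hn _
    _ = _ := by rw [hξ, hη]; ring

lemma rowColumnNorm_le_norm_matrixSum {X : Fin n → (E →L[ℂ] E)} {Ω : E} (hΩ : ‖Ω‖ = 1)
    (hX : Orthonormal ℂ fun j => X j Ω) (hs : ∀ j x y, ⟪X j x, y⟫_ℂ = ⟪x, X j y⟫_ℂ)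
    (α : Fin n → Matrix (Fin m) (Fin k) ℂ) :
    rowColumnNorm α ≤ ‖matrixSum α X‖ := by
  refine max_le ?_ (column_le_norm_matrixSum hΩ hX α)
  have h1 := column_le_norm_matrixSum hΩ hX fun j => (α j)ᴴ
  have h2 := norm_matrixSum_le_conjTranspose (fun j => (α j)ᴴ) hs
  simp only [Matrix.conjTranspose_conjTranspose] at h1 h2
  exact h1.trans h2

end MatrixSum

/-! ### The Boolean Gaussians -/

section BooleanBounds

variable {H : Type u} [NormedAddCommGroup H] [InnerProductSpace ℂ H] {n m k : ℕ}

/-- If `A j` and `B j` have orthogonal ranges and live on the ranges of complementary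
orthogonal projections `P` and `Q`, then the norm of `∑ j, α j ⊗ (A j + B j)` is at most the
maximum of the norms of the two parts. -/
lemma norm_matrixSum_add_le {E : Type u} [NormedAddCommGroup E] [InnerProductSpace ℂ E]
    {A B : Fin n → (E →L[ℂ] E)} {P Q : E → E}
    (hPQ : ∀ x, ‖x‖ ^ 2 = ‖P x‖ ^ 2 + ‖Q x‖ ^ 2) (hA : ∀ j x, A j x = A j (P x))
    (hB : ∀ j x, B j x = B j (Q x)) (hAB : ∀ i j x y, ⟪A i x, B j y⟫_ℂ = 0)
    (α : Fin n → Matrix (Fin m) (Fin k) ℂ) {c : ℝ} (hc : 0 ≤ c)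
    (hcA : ‖matrixSum α A‖ ≤ c) (hcB : ‖matrixSum α B‖ ≤ c) :
    ‖matrixSum α fun j => A j + B j‖ ≤ c := by
  refine ContinuousLinearMap.opNorm_le_bound _ hc fun u => ?_
  obtain ⟨v, hu⟩ := exists_eq_sum_basis_tmul u
  have he := (EuclideanSpace.basisFun (Fin k) ℂ).orthonormal
  -- `P` and `Q` need not be linear: they only act on the coordinates `v i` of one fixed expansion
  -- of `u`.
  have h1 : matrixSum α A u
      = matrixSum α A (∑ i, EuclideanSpace.basisFun (Fin k) ℂ i ⊗ₜ[ℂ] P (v i)) := by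
    simp only [hu, map_sum, matrixSum_apply, TensorProduct.mapL_tmul, ← hA]
  have h2 : matrixSum α B u
      = matrixSum α B (∑ i, EuclideanSpace.basisFun (Fin k) ℂ i ⊗ₜ[ℂ] Q (v i)) := by
    simp only [hu, map_sum, matrixSum_apply, TensorProduct.mapL_tmul, ← hB]
  have h3 : ‖u‖ ^ 2 = ‖∑ i, EuclideanSpace.basisFun (Fin k) ℂ i ⊗ₜ[ℂ] P (v i)‖ ^ 2
      + ‖∑ i, EuclideanSpace.basisFun (Fin k) ℂ i ⊗ₜ[ℂ] Q (v i)‖ ^ 2 := by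
    rw [hu, norm_sq_sum_tmul he, norm_sq_sum_tmul he, norm_sq_sum_tmul he,
      ← Finset.sum_add_distrib]
    exact Finset.sum_congr rfl fun i _ => hPQ (v i)
  have h4 : ⟪matrixSum α A u, matrixSum α B u⟫_ℂ = 0 := by
    simp only [hu, map_sum, matrixSum_apply, TensorProduct.mapL_tmul, sum_inner, inner_sum,
      TensorProduct.inner_tmul, hAB, mul_zero, Finset.sum_const_zero]
  have h5 : matrixSum α (fun j => A j + B j) u = matrixSum α A u + matrixSum α B u := by
    rw [matrixSum_add]; rfl
  have h6 := norm_add_sq_eq_norm_sq_add_norm_sq_of_inner_eq_zero (𝕜 := ℂ)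
    (matrixSum α A u) (matrixSum α B u) h4
  refine abs_le_of_sq_le_sq' ?_ (by positivity) |>.2
  -- Pythagoras is used in the target (`h6`) and in the source (`h3`), which is why the bound is `c`
  -- and not `2 * c`.
  rw [h5, sq, h6, h1, h2, mul_pow, h3, mul_add, ← mul_pow, ← mul_pow, ← sq, ← sq]
  gcongr
  · exact ContinuousLinearMap.le_of_opNorm_le _ hcA _
  · exact ContinuousLinearMap.le_of_opNorm_le _ hcB _

lemma booleanCreation_apply (f : H) (v : BooleanFock H) :
    booleanCreation f v = WithLp.toLp 2 (0, v.fst • f) := by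
  simp [booleanCreation]

lemma booleanAnnihilation_apply (f : H) (v : BooleanFock H) :
    booleanAnnihilation f v = WithLp.toLp 2 (⟪f, v.snd⟫_ℂ, 0) := by
  simp [booleanAnnihilation]

lemma inner_booleanAnnihilation (f : H) (x y : BooleanFock H) :
    ⟪booleanAnnihilation f x, y⟫_ℂ = ⟪x, booleanCreation f y⟫_ℂ := by
  simp [booleanCreation_apply, booleanAnnihilation_apply, WithLp.prod_inner_apply,
    inner_smul_right]

lemma inner_booleanCreation (f : H) (x y : BooleanFock H) :
    ⟪booleanCreation f x, y⟫_ℂ = ⟪x, booleanAnnihilation f y⟫_ℂ := by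
  rw [← inner_conj_symm, ← inner_booleanAnnihilation, inner_conj_symm]

lemma norm_sq_sum_booleanCreation_le {f : Fin n → H} (hf : Orthonormal ℂ f)
    (v : Fin n → BooleanFock H) :
    ‖∑ j, booleanCreation (f j) (v j)‖ ^ 2 ≤ 1 * ∑ j, ‖v j‖ ^ 2 := by
  have h1 : ∑ j, booleanCreation (f j) (v j) = WithLp.toLp 2 (0, ∑ j, (v j).fst • f j) := by
    simp only [booleanCreation_apply]
    rw [← WithLp.toLp_sum]
    congr 1
    ext <;> simp [Prod.fst_sum, Prod.snd_sum]
  have h2 : ‖∑ j, (v j).fst • f j‖ ^ 2 = ∑ j, ‖(v j).fst‖ ^ 2 := by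
    have := hf.inner_sum (fun j => (v j).fst) (fun j => (v j).fst) Finset.univ
    rw [inner_self_eq_norm_sq_to_K] at this
    simp only [Complex.conj_mul'] at this
    refine Complex.ofReal_injective ?_
    push_cast
    exact this
  rw [h1, one_mul, WithLp.prod_norm_sq_eq_of_L2]
  have h3 : ‖(0 : ℂ)‖ ^ 2 + ‖∑ j, (v j).fst • f j‖ ^ 2 = ∑ j, ‖(v j).fst‖ ^ 2 := by
    rw [h2]; simp
  refine h3.trans_le (Finset.sum_le_sum fun j _ => ?_)
  rw [WithLp.prod_norm_sq_eq_of_L2 (v j)]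
  exact le_add_of_nonneg_right (sq_nonneg _)

/-- Annihilation sees only the `H` component and lands in `ℂ Ω`; creation sees only `ℂ Ω` and lands
in `H`. -/
lemma norm_matrixSum_booleanGaussian_le {f : Fin n → H} (hf : Orthonormal ℂ f)
    (α : Fin n → Matrix (Fin m) (Fin k) ℂ) :
    ‖matrixSum α fun j => booleanGaussian (f j)‖ ≤ rowColumnNorm α := by
  have hC := norm_matrixSum_le (A := fun j => booleanCreation (f j)) zero_le_one
    (norm_sq_sum_booleanCreation_le hf) α
  have hA := norm_matrixSum_le_of_adjoint (A := fun j => booleanCreation (f j))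
    (B := fun j => booleanAnnihilation (f j)) zero_le_one (norm_sq_sum_booleanCreation_le hf)
    (fun j => inner_booleanAnnihilation (f j)) α
  rw [Real.sqrt_one, one_mul] at hC hA
  have hr : 0 ≤ rowColumnNorm α := (Real.sqrt_nonneg _).trans (le_max_left _ _)
  refine norm_matrixSum_add_le (A := fun j => booleanAnnihilation (f j))
    (B := fun j => booleanCreation (f j)) (P := fun x : BooleanFock H => WithLp.toLp 2 (0, x.snd))
    (Q := fun x : BooleanFock H => WithLp.toLp 2 (x.fst, 0)) (fun x => ?_) (fun j x => ?_)
    (fun j x => ?_) (fun i j x y => ?_) α hr hA hC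
  · rw [WithLp.prod_norm_sq_eq_of_L2, WithLp.prod_norm_sq_eq_of_L2, WithLp.prod_norm_sq_eq_of_L2]
    simp [add_comm]
  · simp only [booleanAnnihilation_apply]
    rfl
  · simp only [booleanCreation_apply]
    rfl
  · simp [booleanCreation_apply, booleanAnnihilation_apply, WithLp.prod_inner_apply]

lemma rowColumnNorm_le_norm_matrixSum_booleanGaussian {f : Fin n → H} (hf : Orthonormal ℂ f)
    (α : Fin n → Matrix (Fin m) (Fin k) ℂ) :
    rowColumnNorm α ≤ ‖matrixSum α fun j => booleanGaussian (f j)‖ := by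
  refine rowColumnNorm_le_norm_matrixSum (Ω := WithLp.toLp 2 (1, 0)) ?_ ?_ ?_ α
  · simp
  · classical
    rw [orthonormal_iff_ite] at hf ⊢
    intro i j
    rw [← hf i j]
    simp [booleanGaussian_apply, WithLp.prod_inner_apply]
  · intro j x y
    simp only [booleanGaussian, _root_.add_apply, inner_add_left, inner_add_right,
      inner_booleanAnnihilation, inner_booleanCreation]
    ring

end BooleanBounds

/-! ### Symmetrizable operators are bounded by their growth rate -/

section Symmetrizable

/-- A sequence with `a (m + 1) ^ 2 ≤ a m * a (m + 2)` and exponential growth rate at most `C`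
satisfies `a 1 ≤ C * a 0`. -/
lemma le_mul_of_logConvex {a : ℕ → ℝ} (ha : ∀ m, 0 ≤ a m)
    (hc : ∀ m, a (m + 1) ^ 2 ≤ a m * a (m + 2)) {C M : ℝ} (hC : 0 < C)
    (hM : ∀ m, a m ≤ C ^ m * M) : a 1 ≤ C * a 0 := by
  by_contra! h
  have h0 : 0 < a 0 := by
    refine lt_of_le_of_ne (ha 0) fun h0 => ?_
    have h1 := hc 0
    rw [← h0, zero_mul] at h1
    have h2 : a 1 = 0 := by simpa using le_antisymm h1 (sq_nonneg _)
    simp [h2, ← h0] at h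
  -- Log-convexity makes the successive ratios nondecreasing, so a first ratio `r > C` would force
  -- growth at least `r ^ m`.
  set r := a 1 / a 0 with hr
  have hr0 : C < r := by rwa [hr, lt_div_iff₀ h0]
  have hrpos : 0 < r := hC.trans hr0
  have key : ∀ m, 0 < a m ∧ r * a m ≤ a (m + 1) := by
    intro m
    induction m with
    | zero => exact ⟨h0, by rw [hr, div_mul_cancel₀ _ h0.ne']⟩
    | succ m ih =>
      have h1 : 0 < a (m + 1) := (mul_pos hrpos ih.1).trans_le ih.2
      refine ⟨h1, le_of_mul_le_mul_left ?_ ih.1⟩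
      calc a m * (r * a (m + 1)) = (r * a m) * a (m + 1) := by ring
        _ ≤ a (m + 1) * a (m + 1) := by gcongr; exact ih.2
        _ = a (m + 1) ^ 2 := by ring
        _ ≤ _ := hc m
  have hpow : ∀ m, r ^ m * a 0 ≤ a m := by
    intro m
    induction m with
    | zero => simp
    | succ m ih =>
      calc r ^ (m + 1) * a 0 = r * (r ^ m * a 0) := by ring
        _ ≤ r * a m := by gcongr
        _ ≤ _ := (key m).2
  obtain ⟨m, hm⟩ := pow_unbounded_of_one_lt (M / a 0) ((one_lt_div hC).2 hr0)
  rw [div_pow, div_lt_div_iff₀ h0 (pow_pos hC _)] at hm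
  have := (hpow m).trans (hM m)
  linarith

variable {V E : Type*} [AddCommGroup V] [Module ℂ V] [NormedAddCommGroup E]
  [InnerProductSpace ℂ E]

/-- An operator which is symmetric for a semi-inner product, and whose powers grow on each
vector at rate at most `C`, is bounded by `C`. -/
lemma norm_le_of_symmetrizable (Φ : V →ₗ[ℂ] E) (R : V →ₗ[ℂ] V)
    (hR : ∀ x y, ⟪Φ (R x), Φ y⟫_ℂ = ⟪Φ x, Φ (R y)⟫_ℂ) {C : ℝ} (hC : 0 < C) {x : V} {M : ℝ}
    (hM : ∀ m : ℕ, ‖Φ ((R ^ m) x)‖ ≤ C ^ m * M) : ‖Φ (R x)‖ ≤ C * ‖Φ x‖ := by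
  have := le_mul_of_logConvex (a := fun m => ‖Φ ((R ^ m) x)‖) (fun _ => norm_nonneg _)
    (fun m => ?_) hC hM
  · simpa using this
  -- Log-convexity of `‖Φ (R ^ m x)‖`: move one `R` across the form, then apply Cauchy–Schwarz.
  · have h1 : ⟪Φ ((R ^ (m + 1)) x), Φ ((R ^ (m + 1)) x)⟫_ℂ
        = ⟪Φ ((R ^ m) x), Φ ((R ^ (m + 2)) x)⟫_ℂ := by
      rw [pow_succ' R (m + 1), pow_succ' R m]
      simp only [Module.End.mul_apply, hR]
    calc ‖Φ ((R ^ (m + 1)) x)‖ ^ 2 = ‖⟪Φ ((R ^ m) x), Φ ((R ^ (m + 2)) x)⟫_ℂ‖ := by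
          rw [← h1, inner_self_eq_norm_sq_to_K (𝕜 := ℂ)]; simp
      _ ≤ _ := norm_inner_le_norm _ _

end Symmetrizable

/-! ### Expanding the `q`-kernel along its first letter -/

section Inversions

lemma inversions_eq_sum {n : ℕ} (π : Equiv.Perm (Fin n)) :
    inversions π = ∑ i, ∑ j, if i < j ∧ π j < π i then 1 else 0 := by
  rw [inversions, Finset.card_filter, ← Finset.univ_product_univ, Finset.sum_product]

/-- The permutation with `0 ↦ k`, whose values at the other points are ordered as those
of `σ`. -/
def consPerm {n : ℕ} (p : Fin (n + 1) × Equiv.Perm (Fin n)) : Equiv.Perm (Fin (n + 1)) :=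
  p.1.cycleRange.symm * Equiv.Perm.decomposeFin.symm (0, p.2)

lemma consPerm_zero {n : ℕ} (k : Fin (n + 1)) (σ : Equiv.Perm (Fin n)) :
    consPerm (k, σ) 0 = k := by
  simp [consPerm]

lemma consPerm_succ {n : ℕ} (k : Fin (n + 1)) (σ : Equiv.Perm (Fin n)) (i : Fin n) :
    consPerm (k, σ) i.succ = k.succAbove (σ i) := by
  simp [consPerm]

lemma consPerm_bijective (n : ℕ) : Function.Bijective (consPerm (n := n)) := by
  rw [Fintype.bijective_iff_injective_and_card]
  constructor
  · rintro ⟨k, σ⟩ ⟨l, τ⟩ h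
    obtain rfl : k = l := by rw [← consPerm_zero k σ, h, consPerm_zero]
    congr 1
    ext i
    have := congrArg (fun π => π i.succ) h
    simp only [consPerm_succ] at this
    rw [k.succAbove_right_injective this]
  · simp [Fintype.card_perm, Nat.factorial_succ]

/-- The position `0` is inverted with exactly those positions whose value lies below `k`, of which
there are `k`; `succAbove` is monotone, so the other pairs behave as under `σ`. -/
lemma inversions_consPerm {n : ℕ} (k : Fin (n + 1)) (σ : Equiv.Perm (Fin n)) :
    inversions (consPerm (k, σ)) = k + inversions σ := by
  have h1 : ∑ j : Fin n, (if k.succAbove (σ j) < k then 1 else 0) = (k : ℕ) := by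
    rw [Equiv.sum_comp σ fun j => if k.succAbove j < k then 1 else 0]
    simp only [Fin.succAbove_lt_iff_castSucc_lt, Finset.sum_boole, Nat.cast_id]
    have : (Finset.univ.filter fun j : Fin n => j.castSucc < k).map Fin.valEmbedding
        = Finset.range k := by
      ext a
      simp only [Finset.mem_map, Finset.mem_filter, Finset.mem_univ, true_and,
        Fin.valEmbedding_apply, Finset.mem_range]
      constructor
      · rintro ⟨j, hj, rfl⟩
        exact hj
      · intro ha
        exact ⟨⟨a, by omega⟩, ha, rfl⟩
    rw [← Finset.card_map, this, Finset.card_range]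
  rw [inversions_eq_sum, inversions_eq_sum, Fin.sum_univ_succ]
  simp only [Fin.sum_univ_succ, consPerm_zero, consPerm_succ, Fin.succ_lt_succ_iff,
    Fin.succAbove_lt_succAbove_iff, lt_irrefl, Fin.not_lt_zero, Fin.succ_pos, false_and, true_and,
    if_false, zero_add]
  rw [h1]

variable {H : Type u} [NormedAddCommGroup H] [InnerProductSpace ℂ H]

lemma qKernel_succ (q : ℝ) {n : ℕ} (x y : Fin (n + 1) → H) :
    qKernel q x y = ∑ k : Fin (n + 1), (q : ℂ) ^ (k : ℕ) *
      (⟪x 0, y k⟫_ℂ * qKernel q (Fin.tail x) (k.removeNth y)) := by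
  rw [qKernel, ← (consPerm_bijective n).sum_comp, Fintype.sum_prod_type]
  refine Finset.sum_congr rfl fun k _ => ?_
  rw [qKernel, Finset.mul_sum, Finset.mul_sum]
  refine Finset.sum_congr rfl fun σ _ => ?_
  simp only [inversions_consPerm, Fin.prod_univ_succ, consPerm_zero, consPerm_succ, pow_add,
    Fin.tail, Fin.removeNth]
  ring

/-- A crude bound, whose factorial is harmless: it enters only the constant `M` of the growth
estimate, never the rate. -/
lemma norm_qKernel_self_le (q : ℝ) (hq : |q| ≤ 1) {n : ℕ} (x : Fin n → H) :
    ‖qKernel q x x‖ ≤ n.factorial * (∏ i, ‖x i‖) ^ 2 := by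
  have h : ∀ π : Equiv.Perm (Fin n),
      ‖(q : ℂ) ^ inversions π * ∏ i, ⟪x i, x (π i)⟫_ℂ‖ ≤ (∏ i, ‖x i‖) ^ 2 := by
    intro π
    rw [norm_mul, norm_pow, Complex.norm_real, Real.norm_eq_abs, norm_prod]
    calc _ ≤ 1 * ∏ i, (‖x i‖ * ‖x (π i)‖) := by
          gcongr
          · exact pow_le_one₀ (abs_nonneg _) hq
          · exact norm_inner_le_norm _ _
      _ = _ := by rw [one_mul, Finset.prod_mul_distrib, Equiv.prod_comp π fun i => ‖x i‖, sq]
  refine (norm_sum_le _ _).trans ((Finset.sum_le_sum fun π _ => h π).trans_eq ?_)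
  simp [Fintype.card_perm]

end Inversions

/-! ### Bounded creation operators and the Khintchine bounds on deformed Fock spaces -/

section Creation

/-- The nonempty word `z` with its letter `k` moved to the front. -/
def moveToFront {H : Type u} (z : Σ n : ℕ, (Fin (n + 1) → H)) (k : Fin (z.1 + 1)) :
    Σ n : ℕ, (Fin (n + 1) → H) :=
  ⟨z.1, Fin.cons (z.2 k) (k.removeNth z.2)⟩

/-- The operator `1 + q T₁ + q² T₁ T₂ + ⋯` on nonempty words. -/
def qShuffle {H : Type u} (q : ℝ) : ((Σ n : ℕ, (Fin (n + 1) → H)) →₀ ℂ) →ₗ[ℂ]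
    ((Σ n : ℕ, (Fin (n + 1) → H)) →₀ ℂ) :=
  Finsupp.linearCombination ℂ fun z =>
    ∑ k : Fin (z.1 + 1), (q : ℂ) ^ (k : ℕ) • Finsupp.single (moveToFront z k) 1

lemma qShuffle_single {H : Type u} (q : ℝ) (z : Σ n : ℕ, (Fin (n + 1) → H)) (a : ℂ) :
    qShuffle q (Finsupp.single z a)
      = a • ∑ k : Fin (z.1 + 1), (q : ℂ) ^ (k : ℕ) • Finsupp.single (moveToFront z k) 1 := by
  rw [qShuffle, Finsupp.linearCombination_single]

variable (D : Deformation) {H : Type u} [NormedAddCommGroup H] [InnerProductSpace ℂ H]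

/-- The canonical linear map from combinations of words to the Fock space. -/
def wordMap : ((Σ n : ℕ, (Fin n → H)) →₀ ℂ) →ₗ[ℂ] Fock D H where
  toFun v := ((show PreFock D H from v : PreFock D H) : Fock D H)
  map_add' v w := UniformSpace.Completion.coe_add (α := PreFock D H) v w
  map_smul' a v := UniformSpace.Completion.coe_smul (M := ℂ) (X := PreFock D H) a v

lemma wordMap_single (x : Σ n : ℕ, (Fin n → H)) (a : ℂ) :
    wordMap D (Finsupp.single x a) = a • word D x.2 := by
  have : Finsupp.single x a = a • Finsupp.single x 1 := by simp
  rw [this, map_smul]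
  rfl

lemma denseRange_wordMap : DenseRange (wordMap D (H := H)) :=
  UniformSpace.Completion.denseRange_coe (α := PreFock D H)

/-- The deformation whose `n`-th weight is the weight of `D` at `n + 1`. -/
def Deformation.shift (D : Deformation) : Deformation where
  q := D.q
  abs_q_le := D.abs_q_le
  weight n := D.weight (n + 1)
  weight_nonneg n := D.weight_nonneg (n + 1)

/-- The deformation with weights `c * w n - w (n + 1)`. -/
def Deformation.gap (D : Deformation) (c : ℝ) (hc : ∀ n, D.weight (n + 1) ≤ c * D.weight n) :
    Deformation where
  q := D.q
  abs_q_le := D.abs_q_le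
  weight n := c * D.weight n - D.weight (n + 1)
  weight_nonneg n := sub_nonneg.2 (hc n)

lemma inner_word_shift {n : ℕ} (x y : Fin n → H) :
    ⟪word D.shift x, word D.shift y⟫_ℂ = (D.weight (n + 1) : ℂ) * qKernel D.q x y :=
  inner_word D.shift x y

lemma inner_word_gap {c : ℝ} (hc : ∀ n, D.weight (n + 1) ≤ c * D.weight n) {n : ℕ}
    (x y : Fin n → H) : ⟪word (D.gap c hc) x, word (D.gap c hc) y⟫_ℂ
      = ((c * D.weight n - D.weight (n + 1) : ℝ) : ℂ) * qKernel D.q x y :=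
  inner_word (D.gap c hc) x y

lemma inner_wordMap_gap (c : ℝ) (hc : ∀ n, D.weight (n + 1) ≤ c * D.weight n)
    (v w : (Σ n : ℕ, (Fin n → H)) →₀ ℂ) :
    c * ⟪wordMap D v, wordMap D w⟫_ℂ
      = ⟪wordMap (D.gap c hc) v, wordMap (D.gap c hc) w⟫_ℂ
        + ⟪wordMap D.shift v, wordMap D.shift w⟫_ℂ := by
  induction v using Finsupp.induction_linear with
  | zero => simp
  | add v v' h h' => simp only [map_add, inner_add_left, mul_add, h, h']; ring
  | single x a =>
    induction w using Finsupp.induction_linear with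
    | zero => simp
    | add w w' h h' => simp only [map_add, inner_add_right, mul_add, h, h']; ring
    | single y b =>
      obtain ⟨n, x⟩ := x
      obtain ⟨m, y⟩ := y
      simp only [wordMap_single, inner_smul_left, inner_smul_right]
      by_cases h : n = m
      · subst h
        simp only [inner_word_gap, inner_word_shift, inner_word D]
        push_cast
        ring
      · simp [inner_word_of_ne _ h]

/-- The weights `c * w n - w (n + 1)` define a deformation of their own, so the difference of the
two forms is positive semidefinite. -/
lemma norm_sq_wordMap_shift_le (c : ℝ) (hc : ∀ n, D.weight (n + 1) ≤ c * D.weight n)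
    (v : (Σ n : ℕ, (Fin n → H)) →₀ ℂ) :
    ‖wordMap D.shift v‖ ^ 2 ≤ c * ‖wordMap D v‖ ^ 2 := by
  have h := inner_wordMap_gap D c hc v v
  simp only [inner_self_eq_norm_sq_to_K] at h
  have h' : c * ‖wordMap D v‖ ^ 2
      = ‖wordMap (D.gap c hc) v‖ ^ 2 + ‖wordMap D.shift v‖ ^ 2 := by
    refine Complex.ofReal_injective ?_
    push_cast
    exact h
  rw [h']
  exact le_add_of_nonneg_left (sq_nonneg _)

/-- Combinations of nonempty words, mapped to the Fock space. -/
def nonemptyWordMap : ((Σ n : ℕ, (Fin (n + 1) → H)) →₀ ℂ) →ₗ[ℂ] Fock D H :=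
  Finsupp.linearCombination ℂ fun z => word D z.2

/-- Combinations of nonempty words, mapped to `H ⊗ F` by splitting off the first letter. -/
def splitWordMap : ((Σ n : ℕ, (Fin (n + 1) → H)) →₀ ℂ) →ₗ[ℂ] H ⊗[ℂ] Fock D.shift H :=
  Finsupp.linearCombination ℂ fun z => z.2 0 ⊗ₜ[ℂ] word D.shift (Fin.tail z.2)

lemma splitWordMap_single (z : Σ n : ℕ, (Fin (n + 1) → H)) (a : ℂ) :
    splitWordMap D (Finsupp.single z a)
      = a • z.2 0 ⊗ₜ[ℂ] word D.shift (Fin.tail z.2) := by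
  rw [splitWordMap, Finsupp.linearCombination_single]

lemma splitWordMap_moveToFront (z : Σ n : ℕ, (Fin (n + 1) → H)) (k : Fin (z.1 + 1)) :
    splitWordMap D (Finsupp.single (moveToFront z k) 1)
      = z.2 k ⊗ₜ[ℂ] word D.shift (k.removeNth z.2) := by
  rw [splitWordMap_single, one_smul]
  rfl

lemma inner_smul_tmul_smul_sum {E ι : Type*} [NormedAddCommGroup E] [InnerProductSpace ℂ E]
    [Fintype ι] (a b : ℂ) (x : H) (u : E) (c : ι → ℂ) (y : ι → H) (v : ι → E) :
    ⟪a • x ⊗ₜ[ℂ] u, b • ∑ k, c k • y k ⊗ₜ[ℂ] v k⟫_ℂ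
      = star a * (b * ∑ k, c k * (⟪x, y k⟫_ℂ * ⟪u, v k⟫_ℂ)) := by
  simp only [TensorProduct.smul_tmul', Finset.smul_sum, inner_sum, TensorProduct.inner_tmul,
    inner_smul_left, inner_smul_right, starRingEnd_apply, Finset.mul_sum]
  exact Finset.sum_congr rfl fun k _ => by ring

/-- This is `qKernel_succ`, its `k`-th term being `q ^ k` times the word with letter `k` moved to
the front. The shift matches weights: a tail of length `n` carries the weight of the full word of
length `n + 1`. -/
lemma inner_nonemptyWordMap (x y : (Σ n : ℕ, (Fin (n + 1) → H)) →₀ ℂ) :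
    ⟪nonemptyWordMap D x, nonemptyWordMap D y⟫_ℂ
      = ⟪splitWordMap D x, splitWordMap D (qShuffle D.q y)⟫_ℂ := by
  induction x using Finsupp.induction_linear with
  | zero => simp
  | add v v' h h' => simp only [map_add, inner_add_left, h, h']
  | single x a =>
    induction y using Finsupp.induction_linear with
    | zero => simp
    | add w w' h h' => simp only [map_add, inner_add_right, h, h']
    | single y b =>
      obtain ⟨n, x⟩ := x
      obtain ⟨m, y⟩ := y
      simp only [nonemptyWordMap, Finsupp.linearCombination_single, qShuffle_single, map_smul,
        map_sum, splitWordMap_moveToFront]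
      have hsplit : ⟪a • x 0 ⊗ₜ[ℂ] word D.shift (Fin.tail x), b • ∑ k : Fin (m + 1),
          (D.q : ℂ) ^ (k : ℕ) • y k ⊗ₜ[ℂ] word D.shift (k.removeNth y)⟫_ℂ
          = star a * (b * ∑ k : Fin (m + 1), (D.q : ℂ) ^ (k : ℕ) * (⟪x 0, y k⟫_ℂ *
            ⟪word D.shift (Fin.tail x), word D.shift (k.removeNth y)⟫_ℂ)) := by
        exact inner_smul_tmul_smul_sum a b (x 0) _ _ y _
      rw [splitWordMap_single, hsplit, inner_smul_left, inner_smul_right]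
      by_cases h : n = m
      · subst h
        simp only [inner_word_shift, inner_word D, qKernel_succ, Finset.mul_sum]
        refine Finset.sum_congr rfl fun k _ => ?_
        rw [← starRingEnd_apply]
        ring
      · have h1 : n + 1 ≠ m + 1 := by omega
        simp [inner_word_of_ne _ h, inner_word_of_ne _ h1]

/-- Both sides equal the Hermitian form `⟪nonemptyWordMap D x, nonemptyWordMap D y⟫`. -/
lemma splitWordMap_qShuffle_symm (x y : (Σ n : ℕ, (Fin (n + 1) → H)) →₀ ℂ) :
    ⟪splitWordMap D (qShuffle D.q x), splitWordMap D y⟫_ℂ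
      = ⟪splitWordMap D x, splitWordMap D (qShuffle D.q y)⟫_ℂ := by
  rw [← inner_nonemptyWordMap, ← inner_conj_symm (splitWordMap D (qShuffle D.q x)),
    ← inner_nonemptyWordMap, inner_conj_symm]

lemma norm_word_le {n : ℕ} (x : Fin n → H) :
    ‖word D x‖ ≤ √(D.weight n * n.factorial) * ∏ i, ‖x i‖ := by
  have h0 : 0 ≤ ∏ i, ‖x i‖ := Finset.prod_nonneg fun _ _ => norm_nonneg _
  refine abs_le_of_sq_le_sq' ?_ (by positivity) |>.2
  have h1 : ‖word D x‖ ^ 2 = ‖⟪word D x, word D x⟫_ℂ‖ := by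
    rw [inner_self_eq_norm_sq_to_K (𝕜 := ℂ)]; simp
  rw [h1, inner_word, norm_mul, Complex.norm_real, Real.norm_of_nonneg (D.weight_nonneg n),
    mul_pow, Real.sq_sqrt (mul_nonneg (D.weight_nonneg n) (by positivity)), mul_assoc]
  exact mul_le_mul_of_nonneg_left (norm_qKernel_self_le _ D.abs_q_le x) (D.weight_nonneg n)

lemma prod_norm_moveToFront {H : Type u} [NormedAddCommGroup H]
    (z : Σ n : ℕ, (Fin (n + 1) → H)) (k : Fin (z.1 + 1)) :
    ∏ i, ‖(moveToFront z k).2 i‖ = ∏ i, ‖z.2 i‖ := by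
  obtain ⟨n, z⟩ := z
  change ∏ i : Fin (n + 1), ‖(Fin.cons (z k) (k.removeNth z) : Fin (n + 1) → H) i‖ = ∏ i, ‖z i‖
  rw [Fin.prod_univ_succ, Fin.prod_univ_succAbove _ k]
  simp [Fin.removeNth]

/-- Each application of `qShuffle` yields rearrangements of the same letters with total coefficient
at most `∑ |q| ^ k ≤ (1 - |q|)⁻¹`, and the crude bound on a word is invariant under rearrangement.
-/
lemma norm_splitWordMap_qShuffle_pow_single_le (hq : |D.q| < 1) (m : ℕ)
    (z : Σ n : ℕ, (Fin (n + 1) → H)) :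
    ‖splitWordMap D ((qShuffle D.q ^ m) (Finsupp.single z 1))‖
      ≤ (1 - |D.q|)⁻¹ ^ m * (√(D.weight (z.1 + 1) * z.1.factorial) * ∏ i, ‖z.2 i‖) := by
  have hq0 : 0 < 1 - |D.q| := sub_pos.2 hq
  induction m generalizing z with
  | zero =>
    rw [pow_zero, Module.End.one_apply, splitWordMap_single, one_smul, TensorProduct.norm_tmul,
      pow_zero, one_mul, Fin.prod_univ_succ, mul_left_comm]
    exact mul_le_mul_of_nonneg_left (norm_word_le D.shift _) (norm_nonneg _)
  | succ m ih =>
    rw [pow_succ, Module.End.mul_apply, qShuffle_single, one_smul]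
    simp only [map_sum, map_smul]
    have h1 : ∀ k : Fin (z.1 + 1), ‖(D.q : ℂ) ^ (k : ℕ) • splitWordMap D ((qShuffle D.q ^ m)
        (Finsupp.single (moveToFront z k) 1))‖ ≤ |D.q| ^ (k : ℕ) * ((1 - |D.q|)⁻¹ ^ m *
          (√(D.weight (z.1 + 1) * z.1.factorial) * ∏ i, ‖z.2 i‖)) := by
      intro k
      rw [norm_smul, norm_pow, Complex.norm_real, Real.norm_eq_abs, ← prod_norm_moveToFront z k]
      exact mul_le_mul_of_nonneg_left (ih (moveToFront z k)) (by positivity)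
    refine (norm_sum_le _ _).trans ((Finset.sum_le_sum fun k _ => h1 k).trans ?_)
    rw [← Finset.sum_mul, pow_succ', mul_assoc]
    refine mul_le_mul_of_nonneg_right ?_ ?_
    · rw [Fin.sum_univ_eq_sum_range fun k => |D.q| ^ k,
        ← tsum_geometric_of_lt_one (abs_nonneg _) hq]
      exact (summable_geometric_of_lt_one (abs_nonneg _) hq).sum_le_tsum _
        fun _ _ => by positivity
    · have : 0 ≤ ∏ i, ‖z.2 i‖ := Finset.prod_nonneg fun _ _ => norm_nonneg _
      positivity

lemma exists_norm_splitWordMap_qShuffle_pow_le (hq : |D.q| < 1)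
    (x : (Σ n : ℕ, (Fin (n + 1) → H)) →₀ ℂ) :
    ∃ M, ∀ m : ℕ, ‖splitWordMap D ((qShuffle D.q ^ m) x)‖ ≤ (1 - |D.q|)⁻¹ ^ m * M := by
  induction x using Finsupp.induction_linear with
  | zero => exact ⟨0, by simp⟩
  | add x y h h' =>
    obtain ⟨M, hM⟩ := h
    obtain ⟨M', hM'⟩ := h'
    refine ⟨M + M', fun m => ?_⟩
    rw [map_add, map_add, mul_add]
    exact (norm_add_le _ _).trans (add_le_add (hM m) (hM' m))
  | single z a =>
    refine ⟨‖a‖ * (√(D.weight (z.1 + 1) * z.1.factorial) * ∏ i, ‖z.2 i‖), fun m => ?_⟩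
    have : Finsupp.single z a = a • Finsupp.single z 1 := by simp
    rw [this, map_smul, map_smul, norm_smul, mul_left_comm]
    exact mul_le_mul_of_nonneg_left (norm_splitWordMap_qShuffle_pow_single_le D hq m z)
      (norm_nonneg _)

lemma norm_sq_nonemptyWordMap_le (hq : |D.q| < 1) (x : (Σ n : ℕ, (Fin (n + 1) → H)) →₀ ℂ) :
    ‖nonemptyWordMap D x‖ ^ 2 ≤ (1 - |D.q|)⁻¹ * ‖splitWordMap D x‖ ^ 2 := by
  obtain ⟨M, hM⟩ := exists_norm_splitWordMap_qShuffle_pow_le D hq x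
  have h1 := norm_le_of_symmetrizable (splitWordMap D) (qShuffle D.q)
    (splitWordMap_qShuffle_symm D) (inv_pos.2 (sub_pos.2 hq)) hM
  calc ‖nonemptyWordMap D x‖ ^ 2 = ‖⟪splitWordMap D x, splitWordMap D (qShuffle D.q x)⟫_ℂ‖ := by
        rw [← inner_nonemptyWordMap, inner_self_eq_norm_sq_to_K (𝕜 := ℂ)]; simp
    _ ≤ ‖splitWordMap D x‖ * ‖splitWordMap D (qShuffle D.q x)‖ :=
        norm_inner_le_norm (𝕜 := ℂ) (splitWordMap D x) (splitWordMap D (qShuffle D.q x))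
    _ ≤ ‖splitWordMap D x‖ * ((1 - |D.q|)⁻¹ * ‖splitWordMap D x‖) := by gcongr
    _ = _ := by ring

/-- Prepending the letter `f` to words. -/
def prepend (f : H) : ((Σ n : ℕ, (Fin n → H)) →₀ ℂ) →ₗ[ℂ]
    ((Σ n : ℕ, (Fin (n + 1) → H)) →₀ ℂ) :=
  Finsupp.lmapDomain ℂ ℂ fun w => ⟨w.1, Fin.cons f w.2⟩

lemma splitWordMap_prepend (f : H) (v : (Σ n : ℕ, (Fin n → H)) →₀ ℂ) :
    splitWordMap D (prepend f v) = f ⊗ₜ[ℂ] wordMap D.shift v := by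
  induction v using Finsupp.induction_linear with
  | zero => simp
  | add v v' h h' => simp only [map_add, TensorProduct.tmul_add, h, h']
  | single x a =>
    simp [prepend, Finsupp.mapDomain_single, splitWordMap_single, wordMap_single]

/-- After splitting off the first letter the sum becomes `∑ f j ⊗ v j`, whose terms are orthogonal.
-/
lemma norm_sq_sum_prepend_le (hq : |D.q| < 1) {c : ℝ}
    (hc : ∀ n, D.weight (n + 1) ≤ c * D.weight n) {N : ℕ} {f : Fin N → H}
    (hf : Orthonormal ℂ f) (v : Fin N → ((Σ n : ℕ, (Fin n → H)) →₀ ℂ)) :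
    ‖∑ j, nonemptyWordMap D (prepend (f j) (v j))‖ ^ 2
      ≤ (1 - |D.q|)⁻¹ * c * ∑ j, ‖wordMap D (v j)‖ ^ 2 := by
  rw [← map_sum]
  refine (norm_sq_nonemptyWordMap_le D hq _).trans ?_
  rw [map_sum, mul_assoc]
  simp only [splitWordMap_prepend]
  rw [norm_sq_sum_tmul hf, Finset.mul_sum (a := c)]
  exact mul_le_mul_of_nonneg_left
    (Finset.sum_le_sum fun j _ => norm_sq_wordMap_shift_le D c hc (v j))
    (inv_nonneg.2 (sub_nonneg.2 hq.le))

lemma norm_nonemptyWordMap_prepend_le (hq : |D.q| < 1) {c : ℝ} (hc0 : 0 ≤ c)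
    (hc : ∀ n, D.weight (n + 1) ≤ c * D.weight n) {f : H} (hf : ‖f‖ = 1)
    (v : (Σ n : ℕ, (Fin n → H)) →₀ ℂ) :
    ‖nonemptyWordMap D (prepend f v)‖ ≤ √((1 - |D.q|)⁻¹ * c) * ‖wordMap D v‖ := by
  have hq0 : 0 < 1 - |D.q| := sub_pos.2 hq
  -- A single unit vector is an orthonormal system with `N = 1`.
  have h := norm_sq_sum_prepend_le D hq hc (N := 1) (f := fun _ => f)
    ⟨fun _ => hf, fun i j hij => absurd (Subsingleton.elim i j) hij⟩ fun _ => v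
  refine abs_le_of_sq_le_sq' ?_ (by positivity) |>.2
  rw [mul_pow, Real.sq_sqrt (by positivity)]
  simpa using h

lemma exists_creation (hq : |D.q| < 1) {c : ℝ} (hc0 : 0 ≤ c)
    (hc : ∀ n, D.weight (n + 1) ≤ c * D.weight n) {f : H} (hf : ‖f‖ = 1) :
    ∃ A : Fock D H →L[ℂ] Fock D H,
      ∀ v, A (wordMap D v) = nonemptyWordMap D (prepend f v) := by
  let L : PreFock D H →L[ℂ] Fock D H := LinearMap.mkContinuous
    (show PreFock D H →ₗ[ℂ] Fock D H from nonemptyWordMap D ∘ₗ prepend f)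
    (√((1 - |D.q|)⁻¹ * c)) fun v =>
      (norm_nonemptyWordMap_prepend_le D hq hc0 hc hf v).trans_eq
        (congrArg _ (UniformSpace.Completion.norm_coe (E := PreFock D H) v))
  exact ⟨L.extend (UniformSpace.Completion.toComplL (𝕜 := ℂ) (E := PreFock D H)), fun v =>
    L.extend_eq UniformSpace.Completion.denseRange_coe
      (UniformSpace.Completion.isUniformInducing_coe _) v⟩

lemma isCreation_of_wordMap {f : H} {A : Fock D H →L[ℂ] Fock D H}
    (hA : ∀ v, A (wordMap D v) = nonemptyWordMap D (prepend f v)) : IsCreation D f A := by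
  intro n x
  have := hA (Finsupp.single ⟨n, x⟩ 1)
  rw [wordMap_single, one_smul] at this
  refine this.trans ?_
  simp [prepend, Finsupp.mapDomain_single, nonemptyWordMap]
  rfl

lemma norm_sq_sum_creation_le (hq : |D.q| < 1) {c : ℝ}
    (hc : ∀ n, D.weight (n + 1) ≤ c * D.weight n) {N : ℕ} {f : Fin N → H}
    (hf : Orthonormal ℂ f) {A : Fin N → (Fock D H →L[ℂ] Fock D H)}
    (hA : ∀ j v, A j (wordMap D v) = nonemptyWordMap D (prepend (f j) v))
    (v : Fin N → Fock D H) :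
    ‖∑ j, A j (v j)‖ ^ 2 ≤ (1 - |D.q|)⁻¹ * c * ∑ j, ‖v j‖ ^ 2 := by
  refine (DenseRange.piMap fun _ : Fin N => denseRange_wordMap D (H := H)).induction_on
    (p := fun v : Fin N → Fock D H =>
      ‖∑ j, A j (v j)‖ ^ 2 ≤ (1 - |D.q|)⁻¹ * c * ∑ j, ‖v j‖ ^ 2) v ?_ fun w => ?_
  · exact isClosed_le (by fun_prop) (by fun_prop)
  · simp only [Pi.map_apply, hA]
    exact norm_sq_sum_prepend_le D hq hc hf w

lemma norm_vacuum (h0 : D.weight 0 = 1) : ‖word D (Fin.elim0 : Fin 0 → H)‖ = 1 := by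
  have h : ⟪word D (Fin.elim0 : Fin 0 → H), word D (Fin.elim0 : Fin 0 → H)⟫_ℂ = 1 := by
    rw [inner_word, h0]
    simp [qKernel, inversions]
  rw [inner_self_eq_norm_sq_to_K (𝕜 := ℂ)] at h
  have h' : ‖word D (Fin.elim0 : Fin 0 → H)‖ ^ 2 = 1 := by
    refine Complex.ofReal_injective ?_
    push_cast
    exact h
  exact (pow_eq_one_iff_of_nonneg (norm_nonneg _) two_ne_zero).1 h'

/-- Creation raises the degree, so its range is orthogonal to the vacuum. -/
lemma adjoint_creation_vacuum {f : H} {A : Fock D H →L[ℂ] Fock D H} (hA : IsCreation D f A) :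
    ContinuousLinearMap.adjoint A (word D (Fin.elim0 : Fin 0 → H)) = 0 := by
  refine eq_of_inner_word D fun n x => ?_
  rw [ContinuousLinearMap.adjoint_inner_right, inner_zero_right]
  exact (congrArg (fun y => ⟪y, _⟫_ℂ) (hA n x)).trans (inner_word_of_ne D n.succ_ne_zero _ _)

lemma matrixKhintchine_of_weight_le (hq : |D.q| < 1) (h0 : D.weight 0 = 1) (h1 : D.weight 1 = 1)
    {c : ℝ} (hc : ∀ n, D.weight (n + 1) ≤ c * D.weight n) :
    MatrixKhintchine.{u} D 1 (2 * √((1 - |D.q|)⁻¹ * c)) := by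
  intro H _ _ _ N f hf
  have hc0 : 0 ≤ c := by
    have := hc 0
    rw [h0, h1] at this
    linarith
  have hK : 0 ≤ (1 - |D.q|)⁻¹ * c := mul_nonneg (inv_nonneg.2 (sub_nonneg.2 hq.le)) hc0
  choose A hA using fun j => exists_creation D hq hc0 hc (hf.1 j)
  have hcr := fun j => isCreation_of_wordMap D (hA j)
  have hrow := norm_sq_sum_creation_le D hq hc hf hA
  refine ⟨fun j => A j + ContinuousLinearMap.adjoint (A j), fun j => ⟨A j, hcr j, rfl⟩,
    fun m k α => ⟨?_, ?_⟩⟩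
  · rw [one_mul]
    refine rowColumnNorm_le_norm_matrixSum (norm_vacuum D (H := H) h0) ?_ (fun j x y => ?_) α
    · classical
      have hv : ∀ j, (A j + ContinuousLinearMap.adjoint (A j)) (word D (Fin.elim0 : Fin 0 → H))
          = word D (Fin.cons (f j) Fin.elim0 : Fin 1 → H) := by
        intro j
        rw [_root_.add_apply, adjoint_creation_vacuum D (hcr j), add_zero]
        exact hcr j 0 Fin.elim0
      simp only [hv]
      rw [orthonormal_iff_ite] at hf ⊢
      intro i j
      rw [← hf i j, inner_word, h1]
      have hi : inversions (1 : Equiv.Perm (Fin 1)) = 0 := by decide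
      simp [qKernel, hi]
    · simp only [_root_.add_apply, inner_add_left, inner_add_right,
        ContinuousLinearMap.adjoint_inner_left, ContinuousLinearMap.adjoint_inner_right]
      ring
  -- One copy of the bound for creation, one for annihilation.
  · rw [matrixSum_add, two_mul, add_mul]
    refine (norm_add_le (matrixSum α A)
      (matrixSum α fun j => ContinuousLinearMap.adjoint (A j))).trans ?_
    exact add_le_add (norm_matrixSum_le hK hrow α) (norm_matrixSum_le_of_adjoint hK hrow
      (fun j x y => ContinuousLinearMap.adjoint_inner_left (A j) y x) α)

lemma exists_matrixKhintchine (hq : |D.q| < 1) (h0 : D.weight 0 = 1) (h1 : D.weight 1 = 1)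
    {c : ℝ} (hc : ∀ n, D.weight (n + 1) ≤ c * D.weight n) :
    ∃ K₁ > 0, ∃ K₂ > 0, MatrixKhintchine.{u} D K₁ K₂ := by
  have hc0 : 1 ≤ c := by simpa [h0, h1] using hc 0
  have hq0 : 0 < 1 - |D.q| := sub_pos.2 hq
  exact ⟨1, one_pos, 2 * √((1 - |D.q|)⁻¹ * c), by positivity,
    matrixKhintchine_of_weight_le D hq h0 h1 hc⟩

end Creation

end FockKhintchine

end

/-! ### The four families -/

open FockKhintchine
theorem theorem8 :
    (∀ (q : ℝ) (hq : |q| < 1), ∃ K₁ > 0, ∃ K₂ > 0,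
      MatrixKhintchine.{u} (qContinuous q hq) K₁ K₂) ∧
    (∀ (q : ℝ) (h0 : 0 ≤ q) (h1 : q < 1), ∃ K₁ > 0, ∃ K₂ > 0,
      MatrixKhintchine.{u} (qDiscrete q h0 h1) K₁ K₂) ∧
    (∀ (t : ℝ) (ht : 0 ≤ t), ∃ K₁ > 0, ∃ K₂ > 0,
      MatrixKhintchine.{u} (kesten t ht) K₁ K₂) ∧
    (∀ (H : Type u) [NormedAddCommGroup H] [InnerProductSpace ℂ H] [CompleteSpace H]
      (n : ℕ) (f : Fin n → H), Orthonormal ℂ f →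
      ∀ (m k : ℕ) (α : Fin n → Matrix (Fin m) (Fin k) ℂ),
        ‖matrixSum α fun j => booleanGaussian (f j)‖ = rowColumnNorm α) := by
  refine ⟨fun q hq => ?_, fun q h0 h1 => ?_, fun t ht => ?_, fun H _ _ _ n f hf m k α => ?_⟩
  · exact exists_matrixKhintchine (c := 1) (qContinuous q hq) hq rfl rfl fun n => by
      simp [qContinuous]
  · refine exists_matrixKhintchine (c := 1) (qDiscrete q h0 h1) ?_ ?_ ?_ fun n => ?_
    · simpa [qDiscrete, abs_of_nonneg h0] using h1
    · simp [qDiscrete]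
    · simp [qDiscrete]
    -- The weights `q ^ n.choose 2` are nonincreasing, also for `q = 0`, where `0 ^ 0 = 1`.
    · simp only [qDiscrete, one_mul]
      exact pow_le_pow_of_le_one h0 h1.le (Nat.choose_le_choose 2 n.le_succ)
  -- The first weight ratio is 1, since truncated subtraction gives `w 0 = w 1 = 1`; each later
  -- weight is `t` times the preceding one.
  · refine exists_matrixKhintchine (c := max 1 t) (kesten t ht) ?_ ?_ ?_ fun n => ?_
    · simp [kesten]
    · simp [kesten]
    · simp [kesten]
    · cases n with
      | zero => simp [kesten]
      | succ n =>
        simp only [kesten, Nat.add_sub_cancel, pow_succ']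
        exact mul_le_mul_of_nonneg_right (le_max_right _ _) (pow_nonneg ht n)
  · exact le_antisymm (norm_matrixSum_booleanGaussian_le hf α)
      (rowColumnNorm_le_norm_matrixSum_booleanGaussian hf α)
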